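/- All algebras are unital and complex. A Hopf $*$-algebra is a complex Hopf algebra $H$ that is a $*$-algebra such that $\Delta$ is a $*$-homomorphism and $x\mapsto S(x)^*$ is an involution. Morphisms of Hopf $*$-algebras are the bialgebra morphisms commuting with $S$ and $*$. Its finite dual $H^\circ$ is the Hopf $*$-algebra of linear functionals on $H$ vanishing on a two-sided $*$-ideal of finite codimension, with $(fg)(x)=f(x_1)g(x_2)$, $1=\varepsilon$, $\Delta(f)(x\otimes y)=f(xy)$, $\varepsilon(f)=f(1)$, $S(f)=f\circ S$ and $f^*(x)=\overline{f(S(x)^*)}$. Let $B$ be a finite-dimensional $*$-algebra and $\tau$ a state on $B$ (a linear functional with $\tau(1)=1$ and $\tau(x^*x)\ge 0$ for all $x$). An action of $H$ on $B$ is a left $H$-module structure with $h\cdot(xy)=(h_1\cdot x)(h_2\cdot y)$, $h\cdot 1=\varepsilon(h)1$ and $(h\cdot x)^*=S(h)^*\cdot x^*$; it is $\tau$-preserving if $\tau(h\cdot x)=\varepsilon(h)\tau(x)$. The quantum Galois group $\mathrm{QGal}_\tau(\mathbb C\subset B)$ is the terminal object of the category of Hopf $*$-algebras with a $\tau$-preserving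 action on $B$ that fixes $\mathbb C 1$, i.e. $h\cdot z1=\varepsilon(h)z1$, whose morphisms are the Hopf $*$-algebra morphisms intertwining the actions. A coaction of $H$ on $B$ is a coassociative, counital, unital $*$-homomorphism $\rho:B\to B\otimes H$; it is $\tau$-preserving if $(\tau\otimes\mathrm{id})\rho(b)=\tau(b)1$. The quantum automorphism group $Q_{aut}(B,\tau)$ is the universal Hopf $*$-algebra with a $\tau$-preserving coaction on $B$: every $\tau$-preserving coaction $\sigma:B\to B\otimes H$ of a Hopf $*$-algebra $H$ is $\sigma=(\mathrm{id}\otimes\varphi)\rho$ for a unique Hopf $*$-algebra morphism $\varphi:Q_{aut}(B,\tau)\to H$. If $\tau$ is faithful, one may also take for $Q_{aut}(B,\tau)$ Wang's compact quantum group, that is, a CQG algebra (a Hopf $*$-algebra spanned by the matrix coefficients of its finite-dimensional unitary corepresentations) with a $\tau$-preserving coaction that has this universal property among CQG algebras. **Theorem.** The Hopf $*$-algebra $Q_{aut}(B,\tau)$ exists (for faithful $\tau$, in both senses). In either sense, its finite dual $Q_{aut}(B,\tau)^\circ$, with the action $f\cdot b=(\mathrm{id}\otimes f)\rho(b)$,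 is a terminal object of the category defining $\mathrm{QGal}_\tau(\mathbb C\subset B)$. Consequently $\mathrm{QGal}_\tau(\mathbb C\subset B)\cong Q_{aut}(B,\tau)^\circ$ as Hopf $*$-algebras, by an isomorphism that intertwines the actions on $B$. -/

import Mathlib

open scoped TensorProduct

universe u v

noncomputable section

namespace QuantumSymmetry

open Coalgebra HopfAlgebra WithConv

/-! ## Hopf `*`-algebras -/

/-- A Hopf `*`-algebra: a complex Hopf algebra which is a `*`-algebra, whose comultiplication is a
morphism of `*`-algebras (for the involution `(x ⊗ y)* = x* ⊗ y*`), and for which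
`x ↦ S(x)*` is an involution. -/
class HopfStarAlgebra (H : Type v) [Ring H] extends
    HopfAlgebra ℂ H, StarRing H, StarModule ℂ H where
  comul_star : ∀ x : H, (comul (star x) : H ⊗[ℂ] H) = Star.star (comul x)
  star_antipode_star_antipode : ∀ x : H, star (antipode (star (antipode x))) = x

/-- A bialgebra morphism between Hopf `*`-algebras is a morphism of Hopf `*`-algebras if it
commutes with the antipodes and with the involutions. -/
structure IsHopfStarHom {H K : Type*} [Ring H] [HopfStarAlgebra H] [Ring K] [HopfStarAlgebra K]
    (φ : H →ₐc[ℂ] K) : Prop where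
  map_antipode : ∀ x, φ (antipode ℂ x) = antipode ℂ (φ x)
  map_star : ∀ x, φ (star x) = star (φ x)

/-- A Hopf `*`-algebra is a CQG algebra (the algebra of representative functions on a compact
quantum group) if it is the linear span of the matrix coefficients of its finite-dimensional
unitary corepresentations. -/
def IsCQGAlgebra (A : Type v) [Ring A] [HopfStarAlgebra A] : Prop :=
  Submodule.span ℂ {x : A | ∃ (n : ℕ) (w : Matrix (Fin n) (Fin n) A),
    (∀ i j, comul (R := ℂ) (w i j) = ∑ k, w i k ⊗ₜ[ℂ] w k j) ∧
    (∀ i j, counit (R := ℂ) (w i j) = if i = j then 1 else 0) ∧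
    star w * w = 1 ∧ w * star w = 1 ∧ ∃ i j, x = w i j} = ⊤

/-! ## The finite dual -/

section FiniteDual

variable (A : Type v) [Ring A] [HopfStarAlgebra A]

/-- A linear functional belongs to the finite dual if it vanishes on a two-sided `*`-ideal of
finite codimension. -/
def IsRepresentative {A : Type v} [Ring A] [HopfStarAlgebra A] (f : A →ₗ[ℂ] ℂ) : Prop :=
  ∃ I : Submodule ℂ A,
    (∀ a x, x ∈ I → a * x ∈ I ∧ x * a ∈ I) ∧ (∀ x ∈ I, star x ∈ I) ∧
    FiniteDimensional ℂ (A ⧸ I) ∧ ∀ x ∈ I, f x = 0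

variable {A}

theorem finite_quot_inf (I J : Submodule ℂ A) [FiniteDimensional ℂ (A ⧸ I)]
    [FiniteDimensional ℂ (A ⧸ J)] : FiniteDimensional ℂ (A ⧸ I ⊓ J) := by
  have h : LinearMap.ker (I.mkQ.prod J.mkQ) = I ⊓ J := by
    rw [LinearMap.ker_prod, Submodule.ker_mkQ, Submodule.ker_mkQ]
  rw [← h]
  exact Module.Finite.equiv (I.mkQ.prod J.mkQ).quotKerEquivRange.symm

/-- The `*`-condition on the ideal in the definition of the finite dual can be dropped. -/
theorem IsRepresentative.of_ideal (f : A →ₗ[ℂ] ℂ) (J : Submodule ℂ A)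
    (hJ : ∀ a x, x ∈ J → a * x ∈ J ∧ x * a ∈ J) [FiniteDimensional ℂ (A ⧸ J)]
    (hf : ∀ x ∈ J, f x = 0) : IsRepresentative f := by
  let K : Submodule ℂ A := J.comap (starLinearEquiv ℂ : A ≃ₗ⋆[ℂ] A).toLinearMap
  have hK : ∀ x, x ∈ K ↔ star x ∈ J := fun x => Iff.rfl
  have hfin : FiniteDimensional ℂ (A ⧸ K) := by
    have hle : J ≤ K.comap (starLinearEquiv ℂ : A ≃ₗ⋆[ℂ] A).toLinearMap := by
      intro x hx
      change star (star x) ∈ J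
      rwa [star_star]
    refine Module.Finite.of_surjective
      (Submodule.mapQ J K (starLinearEquiv ℂ : A ≃ₗ⋆[ℂ] A).toLinearMap hle) ?_
    intro y
    obtain ⟨y, rfl⟩ := K.mkQ_surjective y
    exact ⟨J.mkQ (star y), by simp⟩
  refine ⟨J ⊓ K, ?_, ?_, finite_quot_inf J K, fun x hx => hf x hx.1⟩
  · rintro a x ⟨h1, h2⟩
    refine ⟨⟨(hJ a x h1).1, ?_⟩, ⟨(hJ a x h1).2, ?_⟩⟩
    · change star (a * x) ∈ J
      rw [star_mul]
      exact (hJ _ _ h2).2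
    · change star (x * a) ∈ J
      rw [star_mul]
      exact (hJ _ _ h2).1
  · rintro x ⟨h1, h2⟩
    refine ⟨h2, ?_⟩
    change star (star x) ∈ J
    rwa [star_star]

variable (A)

/-- The finite dual as a subalgebra of the linear dual with the convolution product
`(f * g)(x) = f(x₁) g(x₂)`; the unit is the counit of `A`. -/
def finiteDual : Subalgebra ℂ (WithConv (A →ₗ[ℂ] ℂ)) where
  carrier := {f | IsRepresentative f.ofConv}
  add_mem' := by
    rintro f g ⟨I, hI, hIs, hIf, hf⟩ ⟨J, hJ, hJs, hJf, hg⟩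
    refine ⟨I ⊓ J, fun a x hx => ⟨⟨(hI a x hx.1).1, (hJ a x hx.2).1⟩,
      ⟨(hI a x hx.1).2, (hJ a x hx.2).2⟩⟩, fun x hx => ⟨hIs x hx.1, hJs x hx.2⟩,
      finite_quot_inf I J, fun x hx => ?_⟩
    simp [hf x hx.1, hg x hx.2]
  mul_mem' := by
    rintro f g ⟨I, hI, hIs, hIf, hf⟩ ⟨J, hJ, hJs, hJf, hg⟩
    let Φ : A →ₗ[ℂ] (A ⧸ I) ⊗[ℂ] (A ⧸ J) := TensorProduct.map I.mkQ J.mkQ ∘ₗ comul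
    have hΦ : ∀ a x, Φ x = 0 → Φ (a * x) = 0 ∧ Φ (x * a) = 0 := by
      intro a x hx
      constructor
      · have key : ∀ t : A ⊗[ℂ] A, ∀ p q : A,
            TensorProduct.map I.mkQ J.mkQ ((p ⊗ₜ[ℂ] q) * t) =
              TensorProduct.map (I.mapQ I (LinearMap.mulLeft ℂ p) fun y hy => (hI p y hy).1)
                (J.mapQ J (LinearMap.mulLeft ℂ q) fun y hy => (hJ q y hy).1)
                (TensorProduct.map I.mkQ J.mkQ t) := by
          intro t p q
          induction t with
          | zero => simp
          | tmul y z => rw [Algebra.TensorProduct.tmul_mul_tmul]; rfl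
          | add y z hy hz => rw [mul_add, map_add, hy, hz, map_add, map_add]
        change TensorProduct.map I.mkQ J.mkQ (comul (R := ℂ) x) = 0 at hx
        change TensorProduct.map I.mkQ J.mkQ (comul (R := ℂ) (a * x)) = 0
        rw [Bialgebra.comul_mul, ← (ℛ ℂ a).eq, Finset.sum_mul, map_sum]
        exact Finset.sum_eq_zero fun i _ => by rw [key, hx, map_zero]
      · have key : ∀ t : A ⊗[ℂ] A, ∀ p q : A,
            TensorProduct.map I.mkQ J.mkQ (t * (p ⊗ₜ[ℂ] q)) =
              TensorProduct.map (I.mapQ I (LinearMap.mulRight ℂ p) fun y hy => (hI p y hy).2)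
                (J.mapQ J (LinearMap.mulRight ℂ q) fun y hy => (hJ q y hy).2)
                (TensorProduct.map I.mkQ J.mkQ t) := by
          intro t p q
          induction t with
          | zero => simp
          | tmul y z => rw [Algebra.TensorProduct.tmul_mul_tmul]; rfl
          | add y z hy hz => rw [add_mul, map_add, hy, hz, map_add, map_add]
        change TensorProduct.map I.mkQ J.mkQ (comul (R := ℂ) x) = 0 at hx
        change TensorProduct.map I.mkQ J.mkQ (comul (R := ℂ) (x * a)) = 0
        rw [Bialgebra.comul_mul, ← (ℛ ℂ a).eq, Finset.mul_sum, map_sum]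
        exact Finset.sum_eq_zero fun i _ => by rw [key, hx, map_zero]
    have hfin : FiniteDimensional ℂ (A ⧸ LinearMap.ker Φ) :=
      Module.Finite.equiv Φ.quotKerEquivRange.symm
    refine IsRepresentative.of_ideal _ (LinearMap.ker Φ) (fun a x hx => hΦ a x hx) ?_
    intro x hx
    have h : LinearMap.mul' ℂ ℂ ∘ₗ TensorProduct.map f.ofConv g.ofConv =
        (LinearMap.mul' ℂ ℂ ∘ₗ TensorProduct.map (I.liftQ f.ofConv hf) (J.liftQ g.ofConv hg)) ∘ₗ
          TensorProduct.map I.mkQ J.mkQ := by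
      ext y z
      rfl
    change (LinearMap.mul' ℂ ℂ ∘ₗ TensorProduct.map f.ofConv g.ofConv) (comul (R := ℂ) x) = 0
    have hx' : TensorProduct.map I.mkQ J.mkQ (comul (R := ℂ) x) = 0 := hx
    rw [h, LinearMap.comp_apply, hx', map_zero]
  algebraMap_mem' := by
    intro c
    have hfin : FiniteDimensional ℂ (A ⧸ LinearMap.ker (counit (R := ℂ) (A := A))) :=
      Module.Finite.equiv (counit (R := ℂ) (A := A)).quotKerEquivRange.symm
    refine IsRepresentative.of_ideal _ (LinearMap.ker (counit (R := ℂ) (A := A))) ?_ ?_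
    · intro a x hx
      rw [LinearMap.mem_ker] at hx
      simp [hx]
    · intro x hx
      rw [LinearMap.mem_ker] at hx
      change c • (algebraMap ℂ ℂ) (counit (R := ℂ) x) = 0
      simp [hx]

/-- The finite dual `A°` of a Hopf `*`-algebra `A`. -/
def FiniteDual : Type v := finiteDual A

instance : Ring (FiniteDual A) := inferInstanceAs (Ring (finiteDual A))

instance : Algebra ℂ (FiniteDual A) := inferInstanceAs (Algebra ℂ (finiteDual A))

variable {A}

namespace FiniteDual

/-- The underlying linear functional of an element of `A°`. -/
def toDual : FiniteDual A →ₗ[ℂ] (A →ₗ[ℂ] ℂ) :=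
  (WithConv.linearEquiv ℂ (A →ₗ[ℂ] ℂ)).toLinearMap ∘ₗ (finiteDual A).val.toLinearMap

/-- Build an element of `A°` from a functional. -/
def ofDual (f : A →ₗ[ℂ] ℂ) (hf : IsRepresentative f) : FiniteDual A := ⟨toConv f, hf⟩

/-- Evaluation at an element of `A`. -/
def ev (a : A) : FiniteDual A →ₗ[ℂ] ℂ := LinearMap.applyₗ a ∘ₗ toDual

@[simp] theorem ev_ofDual (f : A →ₗ[ℂ] ℂ) (hf : IsRepresentative f) (a : A) :
    ev a (ofDual f hf) = f a := rfl

theorem isRepresentative (f : FiniteDual A) : IsRepresentative (toDual f) := f.2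

theorem toDual_apply (f : FiniteDual A) (a : A) : toDual f a = ev a f := rfl

theorem ext {f g : FiniteDual A} (h : ∀ a, ev a f = ev a g) : f = g :=
  Subtype.ext (WithConv.ext (LinearMap.ext h))

theorem ev_one (a : A) : ev a (1 : FiniteDual A) = counit (R := ℂ) a := rfl

theorem ev_algebraMap (c : ℂ) (a : A) :
    ev a (algebraMap ℂ (FiniteDual A) c) = c * counit (R := ℂ) a := rfl

theorem ev_mul (f g : FiniteDual A) (a : A) :
    ev a (f * g) = ∑ i ∈ (ℛ ℂ a).index, ev ((ℛ ℂ a).left i) f * ev ((ℛ ℂ a).right i) g :=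
  (ℛ ℂ a).convMul_apply f.1 g.1

theorem ev_mul' {ι : Type*} (f g : FiniteDual A) (a : A) (r : Coalgebra.Repr ℂ a ι) :
    ev a (f * g) = ∑ i ∈ r.index, ev (r.left i) f * ev (r.right i) g :=
  r.convMul_apply f.1 g.1

theorem ev_add_left (a b : A) : ev (a + b) = ev a + ev b :=
  LinearMap.ext fun f => map_add (toDual f) a b

theorem ev_smul_left (c : ℂ) (a : A) : ev (c • a) = c • ev a :=
  LinearMap.ext fun f => map_smul (toDual f) c a

/-- Evaluation of an element of `A° ⊗ A°` at a pair of elements of `A`. -/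
def ev₂ (a b : A) : FiniteDual A ⊗[ℂ] FiniteDual A →ₗ[ℂ] ℂ :=
  LinearMap.mul' ℂ ℂ ∘ₗ TensorProduct.map (ev a) (ev b)

@[simp] theorem ev₂_tmul (a b : A) (f g : FiniteDual A) :
    ev₂ a b (f ⊗ₜ g) = ev a f * ev b g := rfl

theorem tensor_ext {V W : Type*} [AddCommGroup V] [Module ℂ V] [AddCommGroup W] [Module ℂ W]
    {ι κ : Type*} (φ : ι → V →ₗ[ℂ] ℂ) (ψ : κ → W →ₗ[ℂ] ℂ)
    (hφ : ∀ v, (∀ i, φ i v = 0) → v = 0) (hψ : ∀ w, (∀ k, ψ k w = 0) → w = 0)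
    (t : V ⊗[ℂ] W)
    (ht : ∀ i k, LinearMap.mul' ℂ ℂ (TensorProduct.map (φ i) (ψ k) t) = 0) : t = 0 := by
  classical
  let b := Module.Basis.ofVectorSpace ℂ V
  obtain ⟨c, rfl⟩ := (TensorProduct.equivFinsuppOfBasisLeft (N := W) b).symm.surjective t
  have hc : c = 0 := by
    ext j
    refine hψ _ fun k => ?_
    have h0 : ∑ j ∈ c.support, ψ k (c j) • b j = 0 := by
      refine hφ _ fun i => ?_
      have := ht i k
      rw [TensorProduct.equivFinsuppOfBasisLeft_symm_apply, Finsupp.sum, map_sum, map_sum] at this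
      rw [map_sum, ← this]
      refine Finset.sum_congr rfl fun j _ => ?_
      simp [mul_comm]
    by_cases hj : j ∈ c.support
    · exact linearIndependent_iff'.1 b.linearIndependent _ _ h0 j hj
    · rw [Finsupp.notMem_support_iff.1 hj, map_zero]
  rw [hc, map_zero]

theorem ext₂ {s t : FiniteDual A ⊗[ℂ] FiniteDual A} (h : ∀ a b, ev₂ a b s = ev₂ a b t) :
    s = t := by
  refine sub_eq_zero.1 (tensor_ext ev ev (fun v hv => ext hv) (fun v hv => ext hv) _ ?_)
  intro a b
  have := h a b
  change ev₂ a b (s - t) = 0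
  rw [map_sub, this, sub_self]

theorem exists_comul (f : FiniteDual A) :
    ∃ t : FiniteDual A ⊗[ℂ] FiniteDual A, ∀ a b, ev₂ a b t = ev (a * b) f := by
  obtain ⟨I, hI, hIs, hIf, hf⟩ := f.isRepresentative
  let e := Module.finBasis ℂ (A ⧸ I)
  choose s hs using fun i => I.mkQ_surjective (e i)
  let c : ∀ i, FiniteDual A := fun i =>
    ofDual (e.coord i ∘ₗ I.mkQ) ⟨I, hI, hIs, hIf, fun x hx => by
      have : I.mkQ x = 0 := (Submodule.Quotient.mk_eq_zero I).2 hx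
      rw [LinearMap.comp_apply, this, map_zero]⟩
  let g : ∀ i, FiniteDual A := fun i =>
    ofDual (toDual f ∘ₗ LinearMap.mulRight ℂ (s i)) ⟨I, hI, hIs, hIf, fun x hx =>
      hf _ (hI (s i) x hx).2⟩
  refine ⟨∑ i, g i ⊗ₜ c i, fun a b => ?_⟩
  have hb : b - ∑ i, e.coord i (I.mkQ b) • s i ∈ I := by
    refine (Submodule.Quotient.mk_eq_zero I).1 ?_
    change I.mkQ _ = 0
    rw [map_sub, map_sum]
    simp only [map_smul, hs, Module.Basis.coord_apply, e.sum_repr, sub_self]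
  have h := hf _ (hI a _ hb).1
  rw [mul_sub, map_sub, sub_eq_zero] at h
  change _ = toDual f (a * b)
  rw [h, Finset.mul_sum, map_sum, map_sum]
  refine Finset.sum_congr rfl fun i _ => ?_
  rw [mul_smul_comm, map_smul, smul_eq_mul, mul_comm]
  rfl

/-- The comultiplication of `A°`, characterised by `Δ(f)(a ⊗ b) = f(ab)`. -/
def comulₗ : FiniteDual A →ₗ[ℂ] FiniteDual A ⊗[ℂ] FiniteDual A where
  toFun f := (exists_comul f).choose
  map_add' f g := ext₂ fun a b => by
    rw [map_add, (exists_comul _).choose_spec, (exists_comul _).choose_spec,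
      (exists_comul _).choose_spec, map_add]
  map_smul' c f := ext₂ fun a b => by
    rw [RingHom.id_apply, map_smul, (exists_comul _).choose_spec, (exists_comul _).choose_spec,
      map_smul]

theorem ev₂_comulₗ (f : FiniteDual A) (a b : A) : ev₂ a b (comulₗ f) = ev (a * b) f :=
  (exists_comul f).choose_spec a b

/-- Evaluation of an element of `A° ⊗ (A° ⊗ A°)` at a triple of elements of `A`. -/
def ev₃ (a b c : A) : FiniteDual A ⊗[ℂ] (FiniteDual A ⊗[ℂ] FiniteDual A) →ₗ[ℂ] ℂ :=
  LinearMap.mul' ℂ ℂ ∘ₗ TensorProduct.map (ev a) (ev₂ b c)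

theorem ext₃ {s t : FiniteDual A ⊗[ℂ] (FiniteDual A ⊗[ℂ] FiniteDual A)}
    (h : ∀ a b c, ev₃ a b c s = ev₃ a b c t) : s = t := by
  refine sub_eq_zero.1 (tensor_ext ev (fun p : A × A => ev₂ p.1 p.2) (fun v hv => ext hv)
    (fun v hv => ext₂ fun a b => (hv (a, b)).trans (map_zero _).symm) _ ?_)
  rintro a ⟨b, c⟩
  change ev₃ a b c (s - t) = 0
  rw [map_sub, h, sub_self]

theorem ev₃_assoc_rTensor (a b c : A) (t : FiniteDual A ⊗[ℂ] FiniteDual A) :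
    ev₃ a b c (TensorProduct.assoc ℂ _ _ _ (comulₗ.rTensor _ t)) = ev₂ (a * b) c t := by
  induction t with
  | zero => simp
  | add x y hx hy => simp only [map_add, hx, hy]
  | tmul f g =>
    rw [LinearMap.rTensor_tmul, ev₂_tmul, ← ev₂_comulₗ f a b]
    induction comulₗ f with
    | zero => simp
    | add x y hx hy => simp only [TensorProduct.add_tmul, map_add, hx, hy, add_mul]
    | tmul p q => simp [ev₃, mul_assoc]

theorem ev₃_lTensor (a b c : A) (t : FiniteDual A ⊗[ℂ] FiniteDual A) :
    ev₃ a b c (comulₗ.lTensor _ t) = ev₂ a (b * c) t := by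
  induction t with
  | zero => simp
  | add x y hx hy => simp only [map_add, hx, hy]
  | tmul f g => simp [ev₃, ev₂_comulₗ]

instance : Coalgebra ℂ (FiniteDual A) where
  comul := comulₗ
  counit := ev 1
  coassoc := LinearMap.ext fun f => ext₃ fun a b c => by
    simp only [LinearMap.comp_apply, LinearEquiv.coe_coe]
    rw [ev₃_assoc_rTensor, ev₃_lTensor, ev₂_comulₗ, ev₂_comulₗ, mul_assoc]
  rTensor_counit_comp_comul := LinearMap.ext fun f => by
    apply (TensorProduct.lid ℂ (FiniteDual A)).injective
    refine ext fun b => ?_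
    have key : ∀ t : FiniteDual A ⊗[ℂ] FiniteDual A,
        ev b (TensorProduct.lid ℂ _ ((ev (1 : A)).rTensor _ t)) = ev₂ 1 b t := by
      intro t
      induction t with
      | zero => simp
      | add x y hx hy => simp only [map_add, hx, hy]
      | tmul f g => simp
    rw [LinearMap.comp_apply, key, ev₂_comulₗ, one_mul]
    simp
  lTensor_counit_comp_comul := LinearMap.ext fun f => by
    apply (TensorProduct.rid ℂ (FiniteDual A)).injective
    refine ext fun b => ?_
    have key : ∀ t : FiniteDual A ⊗[ℂ] FiniteDual A,
        ev b (TensorProduct.rid ℂ _ ((ev (1 : A)).lTensor _ t)) = ev₂ b 1 t := by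
      intro t
      induction t with
      | zero => simp
      | add x y hx hy => simp only [map_add, hx, hy]
      | tmul f g => simp [mul_comm]
    rw [LinearMap.comp_apply, key, ev₂_comulₗ, mul_one]
    simp

theorem counit_eq (f : FiniteDual A) : counit (R := ℂ) f = ev 1 f := rfl

theorem ev₂_comul (f : FiniteDual A) (a b : A) :
    ev₂ a b (comul (R := ℂ) f) = ev (a * b) f := ev₂_comulₗ f a b

theorem ev₂_mul (a b : A) (s t : FiniteDual A ⊗[ℂ] FiniteDual A) :
    ev₂ a b (s * t) = ∑ i ∈ (ℛ ℂ a).index, ∑ j ∈ (ℛ ℂ b).index,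
      ev₂ ((ℛ ℂ a).left i) ((ℛ ℂ b).left j) s * ev₂ ((ℛ ℂ a).right i) ((ℛ ℂ b).right j) t := by
  induction s with
  | zero => simp
  | add x y hx hy => simp only [add_mul, map_add, hx, hy, Finset.sum_add_distrib]
  | tmul f g =>
    induction t with
    | zero => simp
    | add x y hx hy => simp only [mul_add, map_add, hx, hy, Finset.sum_add_distrib]
    | tmul f' g' =>
      rw [Algebra.TensorProduct.tmul_mul_tmul, ev₂_tmul, ev_mul, ev_mul, Finset.sum_mul_sum]
      refine Finset.sum_congr rfl fun i _ => Finset.sum_congr rfl fun j _ => ?_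
      rw [ev₂_tmul, ev₂_tmul]
      ring

instance : Bialgebra ℂ (FiniteDual A) :=
  Bialgebra.mk' ℂ (FiniteDual A)
    (by rw [counit_eq, ev_one, Bialgebra.counit_one])
    (by
      intro f g
      rw [counit_eq, counit_eq, counit_eq]
      change LinearMap.mul' ℂ ℂ (TensorProduct.map _ _ (comul (R := ℂ) (1 : A))) = _
      rw [Bialgebra.comul_one, Algebra.TensorProduct.one_def]
      rfl)
    (ext₂ fun a b => by
      rw [ev₂_comul, ev_one, Bialgebra.counit_mul]
      rfl)
    (by
      intro f g
      refine ext₂ fun a b => ?_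
      rw [ev₂_comul, ev₂_mul, ev_mul' f g _ ((ℛ ℂ a).mul (ℛ ℂ b))]
      simp only [ev₂_comul]
      exact Finset.sum_product _ _ _)

theorem isRepresentative_comp_antipode {f : A →ₗ[ℂ] ℂ} (hf : IsRepresentative f) :
    IsRepresentative (f ∘ₗ antipode ℂ) := by
  obtain ⟨I, hI, hIs, hIf, hf⟩ := hf
  have hfin : FiniteDimensional ℂ (A ⧸ LinearMap.ker (I.mkQ ∘ₗ antipode ℂ)) :=
    Module.Finite.equiv (I.mkQ ∘ₗ antipode ℂ).quotKerEquivRange.symm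
  have hmem : ∀ x, x ∈ LinearMap.ker (I.mkQ ∘ₗ antipode ℂ (A := A)) ↔ antipode ℂ x ∈ I := by
    intro x
    rw [LinearMap.mem_ker, LinearMap.comp_apply]
    exact Submodule.Quotient.mk_eq_zero I
  refine IsRepresentative.of_ideal _ (LinearMap.ker (I.mkQ ∘ₗ antipode ℂ)) ?_ ?_
  · intro a x hx
    rw [hmem] at hx
    rw [hmem, hmem, antipode_mul_antidistrib, antipode_mul_antidistrib]
    exact ⟨(hI _ _ hx).2, (hI _ _ hx).1⟩
  · intro x hx
    exact hf _ ((hmem x).1 hx)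

/-- The antipode of `A°` is `f ↦ f ∘ S`. -/
def antipodeₗ : FiniteDual A →ₗ[ℂ] FiniteDual A where
  toFun f := ofDual (toDual f ∘ₗ antipode ℂ) (isRepresentative_comp_antipode f.isRepresentative)
  map_add' _ _ := rfl
  map_smul' _ _ := rfl

theorem ev_antipodeₗ (f : FiniteDual A) (a : A) : ev a (antipodeₗ f) = ev (antipode ℂ a) f := rfl

theorem ev_sum_left {ι : Type*} (s : Finset ι) (x : ι → A) (f : FiniteDual A) :
    ev (∑ i ∈ s, x i) f = ∑ i ∈ s, ev (x i) f := map_sum (toDual f) x s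

instance : HopfAlgebra ℂ (FiniteDual A) where
  antipode := antipodeₗ
  mul_antipode_rTensor_comul := LinearMap.ext fun f => ext fun a => by
    have key : ∀ t : FiniteDual A ⊗[ℂ] FiniteDual A,
        ev a (LinearMap.mul' ℂ _ (antipodeₗ.rTensor _ t)) =
          ∑ i ∈ (ℛ ℂ a).index, ev₂ (antipode ℂ ((ℛ ℂ a).left i)) ((ℛ ℂ a).right i) t := by
      intro t
      induction t with
      | zero => simp
      | add x y hx hy => simp only [map_add, hx, hy, Finset.sum_add_distrib]
      | tmul f g => simp [ev_mul, ev_antipodeₗ]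
    rw [LinearMap.comp_apply, LinearMap.comp_apply, key]
    simp only [ev₂_comul]
    rw [← ev_sum_left, sum_antipode_mul_eq_smul, ev_smul_left, LinearMap.comp_apply,
      Algebra.linearMap_apply, ev_algebraMap, counit_eq, LinearMap.smul_apply, smul_eq_mul,
      mul_comm]
  mul_antipode_lTensor_comul := LinearMap.ext fun f => ext fun a => by
    have key : ∀ t : FiniteDual A ⊗[ℂ] FiniteDual A,
        ev a (LinearMap.mul' ℂ _ (antipodeₗ.lTensor _ t)) =
          ∑ i ∈ (ℛ ℂ a).index, ev₂ ((ℛ ℂ a).left i) (antipode ℂ ((ℛ ℂ a).right i)) t := by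
      intro t
      induction t with
      | zero => simp
      | add x y hx hy => simp only [map_add, hx, hy, Finset.sum_add_distrib]
      | tmul f g => simp [ev_mul, ev_antipodeₗ]
    rw [LinearMap.comp_apply, LinearMap.comp_apply, key]
    simp only [ev₂_comul]
    rw [← ev_sum_left, sum_mul_antipode_eq_smul, ev_smul_left, LinearMap.comp_apply,
      Algebra.linearMap_apply, ev_algebraMap, counit_eq, LinearMap.smul_apply, smul_eq_mul,
      mul_comm]

theorem ev_antipode (f : FiniteDual A) (a : A) :
    ev a (antipode ℂ f) = ev (antipode ℂ a) f := rfl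

/-- The functional `x ↦ conj (f (x*))`. -/
def conj (f : FiniteDual A) : FiniteDual A :=
  ofDual
    { toFun := fun x => starRingEnd ℂ (ev (star x) f)
      map_add' := fun x y => by simp [ev_add_left]
      map_smul' := fun c x => by simp [ev_smul_left] } (by
    obtain ⟨I, hI, hIs, hIf, hf⟩ := f.isRepresentative
    refine ⟨I, hI, hIs, hIf, fun x hx => ?_⟩
    change starRingEnd ℂ (toDual f (star x)) = 0
    rw [hf _ (hIs x hx), map_zero])

theorem ev_conj (f : FiniteDual A) (a : A) : ev a (conj f) = starRingEnd ℂ (ev (star a) f) := rfl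

theorem mul'_map_star (f g : FiniteDual A) (t : A ⊗[ℂ] A) :
    LinearMap.mul' ℂ ℂ (TensorProduct.map (toDual f) (toDual g) (star t)) =
      starRingEnd ℂ
        (LinearMap.mul' ℂ ℂ (TensorProduct.map (toDual (conj f)) (toDual (conj g)) t)) := by
  induction t with
  | zero => simp
  | add x y hx hy => simp only [star_add, map_add, hx, hy]
  | tmul x y => simp [toDual_apply, ev_conj]

theorem conj_mul (f g : FiniteDual A) : conj (f * g) = conj f * conj g := ext fun a => by
  have h : ∀ (f g : FiniteDual A) (a : A), ev a (f * g) =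
    LinearMap.mul' ℂ ℂ (TensorProduct.map (toDual f) (toDual g) (comul (R := ℂ) a)) :=
    fun _ _ _ => rfl
  rw [ev_conj, h, h, HopfStarAlgebra.comul_star, mul'_map_star, starRingEnd_self_apply]

theorem antipode_star_antipode (a : A) : antipode ℂ (star (antipode ℂ a)) = star a := by
  have h := HopfStarAlgebra.star_antipode_star_antipode a
  rw [← star_inj, star_star]
  exact h

/-- The involution of `A°`: `f*(x) = conj (f (S(x)*))`. -/
instance : Star (FiniteDual A) := ⟨fun f => antipode ℂ (conj f)⟩

theorem ev_star (f : FiniteDual A) (a : A) :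
    ev a (star f) = starRingEnd ℂ (ev (star (antipode ℂ a)) f) := rfl

instance : StarRing (FiniteDual A) where
  star_involutive f := ext fun a => by
    rw [ev_star, ev_star, starRingEnd_self_apply,
      HopfStarAlgebra.star_antipode_star_antipode]
  star_mul f g := by
    change antipode ℂ (conj (f * g)) = antipode ℂ (conj g) * antipode ℂ (conj f)
    rw [conj_mul, antipode_mul_antidistrib]
  star_add f g := ext fun a => by
    simp [ev_star]

instance : StarModule ℂ (FiniteDual A) where
  star_smul c f := ext fun a => by simp [ev_star]

theorem ev₂_star (a b : A) (t : FiniteDual A ⊗[ℂ] FiniteDual A) :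
    ev₂ a b (star t) =
      starRingEnd ℂ (ev₂ (star (antipode ℂ a)) (star (antipode ℂ b)) t) := by
  induction t with
  | zero => simp
  | add x y hx hy => simp only [star_add, map_add, hx, hy]
  | tmul x y => simp [ev_star]

instance : HopfStarAlgebra (FiniteDual A) where
  comul_star f := ext₂ fun a b => by
    change ev₂ a b (comul (R := ℂ) (star f)) = ev₂ a b (star (comul (R := ℂ) f))
    rw [ev₂_star, ev₂_comul, ev₂_comul, ev_star, antipode_mul_antidistrib, star_mul]
  star_antipode_star_antipode f := ext fun a => by
    change ev a (star (antipode ℂ (star (antipode ℂ f)))) = ev a f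
    rw [ev_star, ev_antipode, ev_star, starRingEnd_self_apply, ev_antipode,
      antipode_star_antipode, antipode_star_antipode, star_star]

end FiniteDual

end FiniteDual

/-! ## Actions and coactions on `*`-algebras -/

section Slice

variable {A : Type v} [Ring A] [HopfStarAlgebra A] {M : Type*} [Ring M] [Algebra ℂ M]

namespace StarCoaction

/-- The slice map `id ⊗ f : M ⊗ A → M`. -/
def slice : FiniteDual A →ₗ[ℂ] M ⊗[ℂ] A →ₗ[ℂ] M where
  toFun f := (TensorProduct.rid ℂ M).toLinearMap ∘ₗ (FiniteDual.toDual f).lTensor M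
  map_add' f g := by
    ext; simp
  map_smul' c f := by
    ext; simp

@[simp] theorem slice_tmul (f : FiniteDual A) (m : M) (a : A) :
    slice f (m ⊗ₜ[ℂ] a) = FiniteDual.ev a f • m := rfl

theorem slice_slice (f g : FiniteDual A) (t : (M ⊗[ℂ] A) ⊗[ℂ] A) :
    slice f (TensorProduct.rid ℂ _ ((FiniteDual.toDual g).lTensor _ t)) =
      TensorProduct.rid ℂ M ((LinearMap.mul' ℂ ℂ ∘ₗ
        TensorProduct.map (FiniteDual.toDual f) (FiniteDual.toDual g)).lTensor M
          (TensorProduct.assoc ℂ M A A t)) := by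
  induction t with
  | zero => simp
  | add x y hx hy => simp only [map_add, hx, hy]
  | tmul s a =>
    induction s with
    | zero => simp
    | add x y hx hy =>
      simp only [TensorProduct.add_tmul, map_add] at hx hy ⊢
      rw [hx, hy]
    | tmul m b =>
      change slice f (FiniteDual.ev a g • (m ⊗ₜ[ℂ] b)) =
        (FiniteDual.ev b f * FiniteDual.ev a g) • m
      rw [map_smul, slice_tmul, smul_smul, mul_comm]

theorem slice_mul (f : FiniteDual A) (s t : M ⊗[ℂ] A) :
    slice f (s * t) = LinearMap.mul' ℂ M (TensorProduct.map (slice.flip s) (slice.flip t)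
      (comul (R := ℂ) f)) := by
  induction s with
  | zero => simp
  | add x y hx hy =>
    rw [add_mul, map_add, hx, hy, map_add, TensorProduct.map_add_left, LinearMap.add_apply, map_add]
  | tmul m a =>
    induction t with
    | zero => simp
    | add x y hx hy =>
      rw [mul_add, map_add, hx, hy, map_add, TensorProduct.map_add_right, LinearMap.add_apply,
        map_add]
    | tmul n b =>
      have key : ∀ u : FiniteDual A ⊗[ℂ] FiniteDual A,
          LinearMap.mul' ℂ M (TensorProduct.map (slice.flip (m ⊗ₜ[ℂ] a))
            (slice.flip (n ⊗ₜ[ℂ] b)) u) = FiniteDual.ev₂ a b u • (m * n) := by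
        intro u
        induction u with
        | zero => simp
        | add x y hx hy => simp only [map_add, hx, hy, add_smul]
        | tmul p q => simp [smul_smul, mul_comm]
      rw [key, FiniteDual.ev₂_comul, Algebra.TensorProduct.tmul_mul_tmul, slice_tmul]

end StarCoaction

end Slice

section Actions

/-- An action of a Hopf `*`-algebra `H` on a `*`-algebra `M`, making `M` a module `*`-algebra. -/
structure StarAction (H M : Type*) [Ring H] [HopfStarAlgebra H]
    [Ring M] [Algebra ℂ M] [StarRing M] [StarModule ℂ M] where
  /-- The action `h ↦ (m ↦ h · m)`. -/
  act : H →ₐ[ℂ] Module.End ℂ M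
  act_one : ∀ h, act h 1 = counit (R := ℂ) h • (1 : M)
  /-- `h · (x y) = (h₁ · x) (h₂ · y)`. -/
  act_mul : ∀ h x y, act h (x * y) =
    LinearMap.mul' ℂ M (TensorProduct.map (act.toLinearMap.flip x) (act.toLinearMap.flip y)
      (comul (R := ℂ) h))
  act_star : ∀ h x, star (act h x) = act (star (antipode ℂ h)) (star x)

/-- A right coaction of a Hopf `*`-algebra `A` on a `*`-algebra `B`: a coassociative, counital,
unital `*`-homomorphism `ρ : B → B ⊗ A`. -/
structure StarCoaction (B A : Type*) [Ring B] [Algebra ℂ B] [StarRing B] [StarModule ℂ B]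
    [Ring A] [HopfStarAlgebra A] where
  /-- The coaction. -/
  coact : B →ₐ[ℂ] B ⊗[ℂ] A
  coassoc : ∀ b, TensorProduct.assoc ℂ B A A (coact.toLinearMap.rTensor A (coact b)) =
    (comul (R := ℂ) (A := A)).lTensor B (coact b)
  counit_coact : ∀ b, TensorProduct.rid ℂ B ((counit (R := ℂ) (A := A)).lTensor B (coact b)) = b
  coact_star : ∀ b, coact (star b) = star (coact b)

variable {H : Type*} [Ring H] [HopfStarAlgebra H]
  {A : Type v} [Ring A] [HopfStarAlgebra A]
  {M : Type*} [Ring M] [Algebra ℂ M] [StarRing M] [StarModule ℂ M]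

/-- The action fixes the subalgebra `N`, i.e. `N` is contained in the invariant subalgebra. -/
def StarAction.Fixes (α : StarAction H M) (N : StarSubalgebra ℂ M) : Prop :=
  ∀ h, ∀ n ∈ N, α.act h n = counit (R := ℂ) h • n

/-- The action preserves the functional `τ`. -/
def StarAction.Preserves (α : StarAction H M) (τ : M →ₗ[ℂ] ℂ) : Prop :=
  ∀ h m, τ (α.act h m) = counit (R := ℂ) h * τ m

/-- The coaction preserves the functional `τ`: `(τ ⊗ id) ρ(b) = τ(b) 1`. -/
def StarCoaction.Preserves (ρ : StarCoaction M A) (τ : M →ₗ[ℂ] ℂ) : Prop :=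
  ∀ b, TensorProduct.lid ℂ A (τ.rTensor A (ρ.coact b)) = τ b • (1 : A)

namespace StarCoaction

theorem star_slice (f : FiniteDual A) (t : M ⊗[ℂ] A) :
    star (slice f t) = slice (star (antipode ℂ f)) (star t) := by
  induction t with
  | zero => simp
  | add x y hx hy => simp only [map_add, star_add, hx, hy]
  | tmul m a =>
    rw [TensorProduct.star_tmul, slice_tmul, slice_tmul, FiniteDual.ev_star,
      FiniteDual.ev_antipode, FiniteDual.antipode_star_antipode, star_star, star_smul]
    rfl

/-- The left action of the finite dual `A°` on `M` attached to a right coaction `ρ` of `A`,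
`f · m = (id ⊗ f) ρ(m)`. -/
def dualAction (ρ : StarCoaction M A) : StarAction (FiniteDual A) M where
  act := AlgHom.ofLinearMap
    { toFun := fun f => slice f ∘ₗ ρ.coact.toLinearMap
      map_add' := fun f g => by rw [map_add, LinearMap.add_comp]
      map_smul' := fun c f => by rw [map_smul, LinearMap.smul_comp]; rfl }
    (LinearMap.ext fun m => ρ.counit_coact m)
    (fun f g => LinearMap.ext fun m => by
      change slice (f * g) (ρ.coact m) = slice f (ρ.coact (slice g (ρ.coact m)))
      have h : ∀ t : M ⊗[ℂ] A, ρ.coact (slice g t) =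
          TensorProduct.rid ℂ _ ((FiniteDual.toDual g).lTensor _
            (ρ.coact.toLinearMap.rTensor A t)) := by
        intro t
        induction t with
        | zero => simp
        | add x y hx hy => simp only [map_add, hx, hy]
        | tmul m a => simp [FiniteDual.toDual_apply]
      rw [h, slice_slice, ρ.coassoc]
      induction ρ.coact m with
      | zero => simp
      | add x y hx hy => simp only [map_add, hx, hy]
      | tmul m a => rfl)
  act_one f := by
    change slice f (ρ.coact 1) = _
    rw [map_one, Algebra.TensorProduct.one_def]
    rfl
  act_mul f x y := by
    change slice f (ρ.coact (x * y)) = _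
    rw [map_mul, slice_mul]
    rfl
  act_star f x := by
    change star (slice f (ρ.coact x)) = slice (star (antipode ℂ f)) (ρ.coact (star x))
    rw [star_slice, ρ.coact_star]

theorem dualAction_apply (ρ : StarCoaction M A) (f : FiniteDual A) (m : M) :
    ρ.dualAction.act f m =
      TensorProduct.rid ℂ M ((FiniteDual.toDual f).lTensor M (ρ.coact m)) := rfl

end StarCoaction

end Actions

/-! ## Quantum Galois groups and quantum automorphism groups -/

section Universal

variable {M : Type u} [Ring M] [Algebra ℂ M] [StarRing M] [StarModule ℂ M]

/-- `(Q, β)` is the quantum Galois group `QGal_τ(N ⊂ M)`: a terminal object of the category of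
Hopf `*`-algebras acting on `M` in a `τ`-preserving way and fixing `N`, with morphisms the
Hopf `*`-algebra morphisms intertwining the actions. -/
structure IsQGal (N : StarSubalgebra ℂ M) (τ : M →ₗ[ℂ] ℂ)
    {Q : Type v} [Ring Q] [HopfStarAlgebra Q] (β : StarAction Q M) : Prop where
  fixes : β.Fixes N
  preserves : β.Preserves τ
  terminal : ∀ (H : Type v) [Ring H] [HopfStarAlgebra H] (α : StarAction H M),
    α.Fixes N → α.Preserves τ →
      ∃! φ : H →ₐc[ℂ] Q, IsHopfStarHom φ ∧ ∀ h m, β.act (φ h) m = α.act h m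

/-- `τ` is a state: unital and positive. -/
structure IsState (τ : M →ₗ[ℂ] ℂ) : Prop where
  map_one : τ 1 = 1
  nonneg : ∀ x, 0 ≤ (τ (star x * x)).re ∧ (τ (star x * x)).im = 0

/-- `τ` is faithful: `τ(x* x) = 0` only for `x = 0`. -/
def IsFaithful (τ : M →ₗ[ℂ] ℂ) : Prop := ∀ x, τ (star x * x) = 0 → x = 0

/-- `(A, ρ)` is the universal Hopf `*`-algebra coacting on `M` in a `τ`-preserving way. -/
structure IsQuantumAutGroup (τ : M →ₗ[ℂ] ℂ)
    {A : Type v} [Ring A] [HopfStarAlgebra A] (ρ : StarCoaction M A) : Prop where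
  preserves : ρ.Preserves τ
  initial : ∀ (H : Type v) [Ring H] [HopfStarAlgebra H] (σ : StarCoaction M H),
    σ.Preserves τ →
      ∃! φ : A →ₐc[ℂ] H, IsHopfStarHom φ ∧
        ∀ m, TensorProduct.map LinearMap.id (φ : A →ₗ[ℂ] H) (ρ.coact m) = σ.coact m

/-- `(A, ρ)` is the (algebra of representative functions on the) compact quantum group which is
universal among the compact quantum groups acting on `M` in a `τ`-preserving way. -/
structure IsCompactQuantumAutGroup (τ : M →ₗ[ℂ] ℂ)
    {A : Type v} [Ring A] [HopfStarAlgebra A] (ρ : StarCoaction M A) : Prop where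
  isCQG : IsCQGAlgebra A
  preserves : ρ.Preserves τ
  initial : ∀ (H : Type v) [Ring H] [HopfStarAlgebra H] (σ : StarCoaction M H),
    IsCQGAlgebra H → σ.Preserves τ →
      ∃! φ : A →ₐc[ℂ] H, IsHopfStarHom φ ∧
        ∀ m, TensorProduct.map LinearMap.id (φ : A →ₗ[ℂ] H) (ρ.coact m) = σ.coact m

end Universal

end QuantumSymmetry

end

open QuantumSymmetry

noncomputable section

namespace QuantumSymmetry

open Coalgebra HopfAlgebra WithConv

/-! ### Exchanging the two arguments of a Hopf pairing. -/

section Transpose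

variable {A : Type v} [Ring A] [HopfStarAlgebra A] {H : Type v} [Ring H] [HopfStarAlgebra H]

namespace FiniteDual

/-! The identification with the finite dual rests on two dualities. First, a Hopf `*`-morphism `A →
H°` and one `H → A°` are the same pairing of `A` with `H` (`transpose`, `isHopfStarHom_transpose`);
landing in the finite dual is automatic by `isRepresentative_transpose`. Second, since `B` is
finite-dimensional, the matrix coefficients of an action of `H` lie in `H°`, so the action is a
coaction of `H°` (`StarAction.dualCoaction`). By `map_coact_eq_iff` the two dualities exchange the
intertwining conditions, so the initial property of `A`, applied to the target `H°`, is the terminal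
property of `A°` at `H`.

For existence, take a basis of self-adjoint elements on which `τ` is real. A coaction is then a
matrix `u` with self-adjoint entries that satisfies polynomial relations. The antipode of a Hopf
`*`-algebra is bijective, so `u` generates a two-sided sequence of matrices `Sⁿ(u)`, each of which
determines its neighbours by inversion, alternately in the algebra and in its opposite. The
universal algebra of such sequences is the required object: its structure maps exist because these
sequences are stable under the corresponding operations (`IsAntipodalSequence.prod`, `.opposite`,
`.conj`), and most identities need checking only on the entries of `a 0`, by
`UniversalAlgebra.ringHom_ext`.

If `τ` is faithful, a basis orthonormal for `τ(x* y)` makes the coefficient matrix unitary, so the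
universal algebra is a CQG algebra (`UniversalAlgebra.isCQGAlgebra`). It therefore has both
universal properties, and any object with the compact one inherits the other
(`IsCompactQuantumAutGroup.isQuantumAutGroup`). -/

theorem ev_add_right (a : A) (f g : FiniteDual A) : ev a (f + g) = ev a f + ev a g := map_add _ _ _

theorem ev₂_map_comul {K : Type v} [Ring K] [HopfStarAlgebra K] (ψ : K →ₗ[ℂ] FiniteDual H)
    (g h : H) (a : K) :
    ev₂ g h (TensorProduct.map ψ ψ (comul (R := ℂ) a)) =
      ∑ i ∈ (ℛ ℂ a).index, ev g (ψ ((ℛ ℂ a).left i)) * ev h (ψ ((ℛ ℂ a).right i)) := by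
  conv_lhs => rw [← (ℛ ℂ a).eq]
  simp

/-- The product of `H` is dual to the comultiplication of `FiniteDual H`, which `ψ` respects. This
makes `transpose` multiplicative. -/
theorem ev_mul_left (ψ : A →ₐc[ℂ] FiniteDual H) (g h : H) (a : A) :
    ev (g * h) (ψ a) =
      ∑ i ∈ (ℛ ℂ a).index, ev g (ψ ((ℛ ℂ a).left i)) * ev h (ψ ((ℛ ℂ a).right i)) := by
  rw [← ev₂_comul, ← CoalgHomClass.map_comp_comul_apply]
  exact ev₂_map_comul (ψ : A →ₗ[ℂ] FiniteDual H) g h a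

/-- Pairing `h` with `ψ (x * a * y)` involves `a` only through the finitely many middle legs `h₂` of
`h₁ ⊗ h₂ ⊗ h₃`. Hence the largest two-sided ideal `J` on which the functional vanishes contains the
common kernel `ker Φ` of finitely many functionals. -/
theorem isRepresentative_transpose (ψ : A →ₐ[ℂ] FiniteDual H) (h : H) :
    IsRepresentative (ev h ∘ₗ ψ.toLinearMap) := by
  let J : Submodule ℂ A :=
    { carrier := {a | ∀ x y, ev h (ψ (x * (a * y))) = 0}
      zero_mem' := by simp
      add_mem' := fun {a b} ha hb x y => by
        rw [add_mul, mul_add, map_add, map_add, ha, hb, add_zero]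
      smul_mem' := fun c a ha x y => by
        rw [smul_mul_assoc, mul_smul_comm, map_smul, map_smul, ha, smul_zero] }
  let r := ℛ ℂ h
  let Φ : A →ₗ[ℂ] ((Σ i : r.index, (ℛ ℂ (r.right i)).index) → ℂ) :=
    LinearMap.pi fun p => ev ((ℛ ℂ (r.right p.1)).left p.2) ∘ₗ ψ.toLinearMap
  have hΦ : LinearMap.ker Φ ≤ J := by
    intro a ha x y
    have ha' : ∀ i ∈ r.index, ∀ j ∈ (ℛ ℂ (r.right i)).index,
        ev ((ℛ ℂ (r.right i)).left j) (ψ a) = 0 :=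
      fun i hi j hj => congrFun (LinearMap.mem_ker.1 ha) ⟨⟨i, hi⟩, ⟨j, hj⟩⟩
    rw [map_mul, ev_mul]
    refine Finset.sum_eq_zero fun i hi => ?_
    rw [map_mul, ev_mul, Finset.sum_eq_zero, mul_zero]
    intro j hj
    rw [ha' i hi j hj, zero_mul]
  have : FiniteDimensional ℂ (A ⧸ LinearMap.ker Φ) := Module.Finite.equiv Φ.quotKerEquivRange.symm
  have : FiniteDimensional ℂ (A ⧸ J) :=
    Module.Finite.of_surjective (Submodule.factor hΦ) (Submodule.factor_surjective hΦ)
  refine IsRepresentative.of_ideal _ J (fun a x hx => ⟨fun y z => ?_, fun y z => ?_⟩)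
    fun x hx => ?_
  · rw [mul_assoc, ← mul_assoc]
    exact hx _ _
  · rw [mul_assoc]
    exact hx _ _
  · simpa using hx 1 1

/-- The morphism `H → A°` obtained from a morphism `A → H°` by exchanging the two arguments of the
associated pairing of `A` and `H`. -/
def transpose (ψ : A →ₐc[ℂ] FiniteDual H) : H →ₐc[ℂ] FiniteDual A :=
  BialgHom.ofAlgHom
    (AlgHom.ofLinearMap
      { toFun := fun h => ofDual (ev h ∘ₗ (ψ : A →ₐ[ℂ] FiniteDual H).toLinearMap)
          (isRepresentative_transpose _ h)
        map_add' := fun g h => ext fun a => by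
          rw [ev_add_right, ev_ofDual, ev_ofDual, ev_ofDual, ev_add_left]
          rfl
        map_smul' := fun c h => ext fun a => by
          rw [map_smul, ev_ofDual, ev_ofDual, ev_smul_left]
          rfl }
      -- Each axiom for the transpose is the dual axiom for `ψ`: unit and product come from its
      -- counit and comultiplication, and conversely.
      (ext fun a => by
        change ev 1 (ψ a) = _
        rw [← counit_eq, CoalgHomClass.counit_comp_apply, ev_one])
      (fun g h => ext fun a => by
        change ev (g * h) (ψ a) = _
        rw [ev_mul, ev_mul_left]
        rfl))
    (AlgHom.ext fun h => by
      change ev h (ψ 1) = counit (R := ℂ) h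
      rw [map_one, ev_one])
    (AlgHom.ext fun h => ext₂ fun a b => by
      refine (ev₂_map_comul _ a b h).trans (Eq.trans ?_ (ev₂_comul _ a b).symm)
      change _ = ev h (ψ (a * b))
      rw [map_mul, ev_mul]
      rfl)

theorem ev_transpose (ψ : A →ₐc[ℂ] FiniteDual H) (h : H) (a : A) :
    ev a (transpose ψ h) = ev h (ψ a) := rfl

/-- The involution of a finite dual involves the antipode, so compatibility with `*` uses both
properties of `ψ`; the leftover `S ∘ * ∘ S` equals `*`. -/
theorem isHopfStarHom_transpose {ψ : A →ₐc[ℂ] FiniteDual H} (hψ : IsHopfStarHom ψ) :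
    IsHopfStarHom (transpose ψ) where
  map_antipode h := ext fun a => by
    rw [ev_antipode, ev_transpose, ev_transpose, hψ.map_antipode, ev_antipode]
  map_star h := ext fun a => by
    rw [ev_star, ev_transpose, ev_transpose, hψ.map_star, hψ.map_antipode, ev_star,
      starRingEnd_self_apply, ev_antipode, antipode_star_antipode]

end FiniteDual

end Transpose

/-! ### Slicing `B ⊗ H°` by evaluation at elements of `H`. -/

section EvSlice

open FiniteDual StarCoaction

variable {B : Type u} [Ring B] [Algebra ℂ B] {H : Type v} [Ring H] [HopfStarAlgebra H]

/-- The slice map `id ⊗ ev_h : B ⊗ H° → B`. -/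
def evSlice (h : H) : B ⊗[ℂ] FiniteDual H →ₗ[ℂ] B :=
  (TensorProduct.rid ℂ B).toLinearMap ∘ₗ (ev h).lTensor B

@[simp] theorem evSlice_tmul (h : H) (b : B) (f : FiniteDual H) :
    evSlice h (b ⊗ₜ[ℂ] f) = ev h f • b := rfl

/-- Functionals on `V` separate points, so `tensor_ext` needs a given separating family only on `W`.
It serves for `W = H°` and, in coassociativity, for `W = H° ⊗ H°`. -/
theorem lTensor_ext {V W : Type*} [AddCommGroup V] [Module ℂ V] [AddCommGroup W] [Module ℂ W]
    {κ : Type*} (ψ : κ → W →ₗ[ℂ] ℂ) (hψ : ∀ w, (∀ k, ψ k w = 0) → w = 0) {s t : V ⊗[ℂ] W}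
    (h : ∀ k, (TensorProduct.rid ℂ V) ((ψ k).lTensor V s) =
      (TensorProduct.rid ℂ V) ((ψ k).lTensor V t)) : s = t := by
  refine sub_eq_zero.1 (tensor_ext (fun φ : Module.Dual ℂ V => φ) ψ
    (fun v hv => (Module.forall_dual_apply_eq_zero_iff ℂ v).1 hv) hψ _ fun φ k => ?_)
  have key : ∀ t : V ⊗[ℂ] W, LinearMap.mul' ℂ ℂ (TensorProduct.map φ (ψ k) t) =
      φ ((TensorProduct.rid ℂ V) ((ψ k).lTensor V t)) := by
    intro t
    induction t with
    | zero => simp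
    | add x y hx hy => simp only [map_add, hx, hy]
    | tmul x y => simp [mul_comm]
  rw [key, map_sub, map_sub, h, sub_self, map_zero]

theorem evSlice_ext {s t : B ⊗[ℂ] FiniteDual H} (h : ∀ x : H, evSlice x s = evSlice x t) :
    s = t :=
  lTensor_ext ev (fun _ hv => FiniteDual.ext hv) h

theorem evSlice_one (h : H) :
    evSlice h (1 : B ⊗[ℂ] FiniteDual H) = counit (R := ℂ) h • (1 : B) := rfl

theorem evSlice_mul (h : H) (s t : B ⊗[ℂ] FiniteDual H) :
    evSlice h (s * t) = ∑ i ∈ (ℛ ℂ h).index,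
      evSlice ((ℛ ℂ h).left i) s * evSlice ((ℛ ℂ h).right i) t := by
  induction s with
  | zero => simp
  | add x y hx hy => simp only [add_mul, map_add, hx, hy, Finset.sum_add_distrib]
  | tmul m f =>
    induction t with
    | zero => simp
    | add x y hx hy => simp only [mul_add, map_add, hx, hy, Finset.sum_add_distrib]
    | tmul n g =>
      simp [ev_mul, Finset.sum_smul, smul_smul, mul_comm]

/-- This identity translates intertwining of coactions into intertwining of actions. -/
theorem evSlice_map {A : Type v} [Ring A] [HopfStarAlgebra A] (ψ : A →ₐc[ℂ] FiniteDual H)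
    (h : H) (t : B ⊗[ℂ] A) :
    evSlice h (TensorProduct.map LinearMap.id (ψ : A →ₗ[ℂ] FiniteDual H) t) =
      slice (transpose ψ h) t := by
  induction t with
  | zero => simp
  | add x y hx hy => simp only [map_add, hx, hy]
  | tmul m f => simp [ev_transpose]

end EvSlice

/-! ### Composition of Hopf `*`-morphisms. -/

section Morphisms

theorem IsHopfStarHom.comp {H K L : Type*} [Ring H] [HopfStarAlgebra H] [Ring K]
    [HopfStarAlgebra K] [Ring L] [HopfStarAlgebra L] {ψ : K →ₐc[ℂ] L} {φ : H →ₐc[ℂ] K}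
    (hψ : IsHopfStarHom ψ) (hφ : IsHopfStarHom φ) : IsHopfStarHom (ψ.comp φ) where
  map_antipode x := by simp [hφ.map_antipode, hψ.map_antipode]
  map_star x := by simp [hφ.map_star, hψ.map_star]

theorem IsHopfStarHom.id {H : Type*} [Ring H] [HopfStarAlgebra H] :
    IsHopfStarHom (BialgHom.id ℂ H) := ⟨fun _ => rfl, fun _ => rfl⟩

end Morphisms

/-! ### Actions of `H` as coactions of its finite dual. -/

section DualCoaction

open FiniteDual StarCoaction

variable {B : Type u} [Ring B] [Algebra ℂ B] [StarRing B] [StarModule ℂ B]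
  {H : Type v} [Ring H] [HopfStarAlgebra H] {A : Type v} [Ring A] [HopfStarAlgebra A]

theorem evSlice_star (h : H) (t : B ⊗[ℂ] FiniteDual H) :
    evSlice h (star t) = star (evSlice (star (antipode ℂ h)) t) := by
  induction t with
  | zero => simp
  | add x y hx hy => simp only [star_add, map_add, hx, hy]
  | tmul m f => simp [ev_star]

theorem StarAction.act_mul_repr (α : StarAction H B) (h : H) (x y : B) :
    α.act h (x * y) = ∑ i ∈ (ℛ ℂ h).index, α.act ((ℛ ℂ h).left i) x * α.act ((ℛ ℂ h).right i) y := by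
  rw [α.act_mul]
  conv_lhs => rw [← (ℛ ℂ h).eq]
  simp

/-- Fixing the scalars is no condition: it follows from linearity and `act_one`. -/
theorem StarCoaction.dualAction_fixes_bot (ρ : StarCoaction B A) :
    ρ.dualAction.Fixes (⊥ : StarSubalgebra ℂ B) := by
  rintro f n hn
  obtain ⟨z, rfl⟩ := StarSubalgebra.mem_bot.1 hn
  rw [Algebra.algebraMap_eq_smul_one, map_smul, ρ.dualAction.act_one, smul_comm]

/-- `τ` and the functional `f` act on different tensor legs, so the order of slicing is irrelevant.
-/
theorem StarCoaction.Preserves.dualAction {ρ : StarCoaction B A} {τ : B →ₗ[ℂ] ℂ}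
    (hρ : ρ.Preserves τ) : ρ.dualAction.Preserves τ := by
  intro f b
  have key : ∀ t : B ⊗[ℂ] A,
      τ (slice f t) = ev (TensorProduct.lid ℂ _ (τ.rTensor _ t)) f := by
    intro t
    induction t with
    | zero => simp [← toDual_apply]
    | add x y hx hy => simp only [map_add, hx, hy, ev_add_left, LinearMap.add_apply]
    | tmul m f => simp [ev_smul_left, mul_comm]
  change τ (slice f (ρ.coact b)) = _
  rw [key, hρ, ev_smul_left, counit_eq, LinearMap.smul_apply, smul_eq_mul, mul_comm]

/-- Terminal objects are unique: each composite of the two comparison maps and the identity solve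
the same terminal problem. -/
theorem IsQGal.exists_equiv {N : StarSubalgebra ℂ B} {τ : B →ₗ[ℂ] ℂ}
    {G Q : Type v} [Ring G] [HopfStarAlgebra G] [Ring Q] [HopfStarAlgebra Q]
    {α : StarAction G B} {β : StarAction Q B}
    (hα : IsQGal.{u, v} N τ α) (hβ : IsQGal.{u, v} N τ β) :
    ∃ e : G ≃ₐc[ℂ] Q, IsHopfStarHom (e : G →ₐc[ℂ] Q) ∧ ∀ g b, β.act (e g) b = α.act g b := by
  obtain ⟨φ, ⟨hφ, hφ'⟩, -⟩ := hβ.terminal G α hα.fixes hα.preserves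
  obtain ⟨ψ, ⟨hψ, hψ'⟩, -⟩ := hα.terminal Q β hβ.fixes hβ.preserves
  refine ⟨BialgEquiv.ofBialgHom φ ψ ?_ ?_, ?_, hφ'⟩
  · exact (hβ.terminal Q β hβ.fixes hβ.preserves).unique
      ⟨hφ.comp hψ, fun h m => (hφ' _ _).trans (hψ' _ _)⟩ ⟨.id, fun _ _ => rfl⟩
  · exact (hα.terminal G α hα.fixes hα.preserves).unique
      ⟨hψ.comp hφ, fun h m => (hψ' _ _).trans (hφ' _ _)⟩ ⟨.id, fun _ _ => rfl⟩
  · rwa [BialgEquiv.coe_ofBialgHom]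

variable [FiniteDimensional ℂ B]

/-- The coefficient vanishes on the kernel of `H → End B`, a two-sided ideal of finite codimension
because `End B` is finite-dimensional. -/
theorem isRepresentative_act (α : StarAction H B) (φ : B →ₗ[ℂ] ℂ) (b : B) :
    IsRepresentative (φ ∘ₗ α.act.toLinearMap.flip b) := by
  have : FiniteDimensional ℂ (H ⧸ LinearMap.ker α.act.toLinearMap) :=
    Module.Finite.equiv α.act.toLinearMap.quotKerEquivRange.symm
  refine IsRepresentative.of_ideal _ (LinearMap.ker α.act.toLinearMap) ?_ ?_
  · intro a x hx
    have hx' : α.act x = 0 := hx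
    simp [hx']
  · intro x hx
    have hx' : α.act x = 0 := hx
    simp [hx']

/-- Expand `h · b` in a basis of `B`; each coordinate, as a function of `h`, is an element of `H°`,
and these are the second legs of `σ b`. -/
theorem exists_dualCoact (α : StarAction H B) :
    ∃ σ : B →ₗ[ℂ] B ⊗[ℂ] FiniteDual H, ∀ h b, evSlice h (σ b) = α.act h b := by
  let e := Module.finBasis ℂ B
  refine ⟨∑ i, TensorProduct.mk ℂ B (FiniteDual H) (e i) ∘ₗ
    { toFun := fun b => ofDual (e.coord i ∘ₗ α.act.toLinearMap.flip b) (isRepresentative_act α _ b)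
      map_add' := fun x y => FiniteDual.ext fun h => by simp
      map_smul' := fun c x => FiniteDual.ext fun h => by simp }, fun h b => ?_⟩
  rw [LinearMap.sum_apply, map_sum]
  exact e.sum_repr (α.act h b)

/-- The coaction of the finite dual `H°` attached to an action of `H` on a finite-dimensional
`*`-algebra. -/
def StarAction.dualCoaction (α : StarAction H B) : StarCoaction B (FiniteDual H) where
  coact := AlgHom.ofLinearMap (exists_dualCoact α).choose
    (evSlice_ext fun h => by
      rw [(exists_dualCoact α).choose_spec, α.act_one, evSlice_one])
    (fun x y => evSlice_ext fun h => by
      rw [(exists_dualCoact α).choose_spec, evSlice_mul, α.act_mul_repr]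
      simp only [(exists_dualCoact α).choose_spec])
  coassoc b := by
    have hσ := (exists_dualCoact α).choose_spec
    set σ := (exists_dualCoact α).choose
    change TensorProduct.assoc ℂ B _ _ (σ.rTensor _ (σ b)) = (comul (R := ℂ)).lTensor B (σ b)
    refine lTensor_ext (fun p : H × H => ev₂ p.1 p.2)
      (fun v hv => ext₂ fun a b => (hv (a, b)).trans (map_zero _).symm) fun p => ?_
    obtain ⟨g, h⟩ := p
    -- Evaluated at `g ⊗ h`, one side of coassociativity acts by `h` and then by `g`, the other by
    -- `g * h`: it is the module axiom.
    have h1 : ∀ t : B ⊗[ℂ] FiniteDual H, TensorProduct.rid ℂ B ((ev₂ g h).lTensor B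
        (TensorProduct.assoc ℂ B _ _ (σ.rTensor _ t))) = evSlice g (σ (evSlice h t)) := by
      intro t
      induction t with
      | zero => simp
      | add x y hx hy => simp only [map_add, hx, hy]
      | tmul m f =>
        rw [LinearMap.rTensor_tmul, evSlice_tmul, map_smul, map_smul]
        induction σ m with
        | zero => simp
        | add x y hx hy => simp only [TensorProduct.add_tmul, map_add, hx, hy, smul_add]
        | tmul n f' => simp [smul_smul, mul_comm]
    have h2 : ∀ t : B ⊗[ℂ] FiniteDual H, TensorProduct.rid ℂ B ((ev₂ g h).lTensor B
        ((comul (R := ℂ)).lTensor B t)) = evSlice (g * h) t := by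
      intro t
      induction t with
      | zero => simp
      | add x y hx hy => simp only [map_add, hx, hy]
      | tmul m f => simp [ev₂_comul]
    rw [h1, h2, hσ, hσ, hσ, map_mul]
    rfl
  counit_coact b := by
    change evSlice 1 ((exists_dualCoact α).choose b) = b
    rw [(exists_dualCoact α).choose_spec, map_one]
    rfl
  -- `evSlice_star` replaces `h` by `S(h)*` and `act_star` does so once more; this map is an
  -- involution.
  coact_star b := evSlice_ext fun h => by
    change evSlice h ((exists_dualCoact α).choose (star b)) =
      evSlice h (star ((exists_dualCoact α).choose b))
    rw [evSlice_star, (exists_dualCoact α).choose_spec, (exists_dualCoact α).choose_spec,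
      α.act_star, HopfStarAlgebra.star_antipode_star_antipode]

theorem StarAction.evSlice_dualCoaction (α : StarAction H B) (h : H) (b : B) :
    evSlice h (α.dualCoaction.coact b) = α.act h b :=
  (exists_dualCoact α).choose_spec h b

theorem StarAction.Preserves.dualCoaction {α : StarAction H B} {τ : B →ₗ[ℂ] ℂ}
    (hα : α.Preserves τ) : α.dualCoaction.Preserves τ := fun b => FiniteDual.ext fun h => by
  have key : ∀ t : B ⊗[ℂ] FiniteDual H,
      ev h (TensorProduct.lid ℂ _ (τ.rTensor _ t)) = τ (evSlice h t) := by
    intro t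
    induction t with
    | zero => simp
    | add x y hx hy => simp only [map_add, hx, hy]
    | tmul m f => simp [mul_comm]
  rw [key, α.evSlice_dualCoaction, hα, map_smul, ev_one, smul_eq_mul, mul_comm]

/-- An element of `B ⊗ H°` is determined by its slices, and slicing at `h` turns `ψ` into `transpose
ψ h`. -/
theorem map_coact_eq_iff (ρ : StarCoaction B A) (α : StarAction H B) (ψ : A →ₐc[ℂ] FiniteDual H) :
    (∀ b, TensorProduct.map LinearMap.id (ψ : A →ₗ[ℂ] FiniteDual H) (ρ.coact b) =
      α.dualCoaction.coact b) ↔ ∀ h b, ρ.dualAction.act (transpose ψ h) b = α.act h b := by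
  constructor
  · intro H h b
    rw [← α.evSlice_dualCoaction, ← H, evSlice_map]
    rfl
  · intro H b
    refine evSlice_ext fun h => ?_
    rw [evSlice_map, α.evSlice_dualCoaction, ← H]
    rfl

/-- The finite dual of the quantum automorphism group is the quantum Galois group. -/
theorem IsQuantumAutGroup.isQGal {τ : B →ₗ[ℂ] ℂ} {ρ : StarCoaction B A}
    (hρ : IsQuantumAutGroup.{u, v} τ ρ) :
    IsQGal.{u, v} (⊥ : StarSubalgebra ℂ B) τ ρ.dualAction where
  fixes := ρ.dualAction_fixes_bot
  preserves := hρ.preserves.dualAction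
  terminal H _ _ α _ hα := by
    obtain ⟨ψ, ⟨hψ, hψ'⟩, huniq⟩ := hρ.initial (FiniteDual H) α.dualCoaction hα.dualCoaction
    refine ⟨transpose ψ, ⟨isHopfStarHom_transpose hψ, (map_coact_eq_iff ρ α ψ).1 hψ'⟩, ?_⟩
    rintro φ ⟨hφ, hφ'⟩
    -- Both morphisms encode one pairing, so transposition is an involution and uniqueness of `ψ`
    -- passes to `φ`.
    have h1 : transpose (transpose φ) = φ := rfl
    rw [← huniq (transpose φ) ⟨isHopfStarHom_transpose hφ, (map_coact_eq_iff ρ α _).2 hφ'⟩, h1]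

end DualCoaction

open MulOpposite (op unop)

/-! ## The universal algebra of a pair of matrix sequences -/

section CoactionMatrix

variable {B : Type u} [Ring B] [Algebra ℂ B] {d : ℕ} (e : Module.Basis (Fin d) ℂ B)
  (τ : B →ₗ[ℂ] ℂ) {C D : Type*} [Ring C] [Algebra ℂ C] [Ring D] [Algebra ℂ D]

/-- The conditions on a matrix `a` over `C` under which `e j ↦ ∑ i, e i ⊗ a i j` defines a
homomorphism of algebras `B → B ⊗ C` that preserves `τ`. -/
structure IsCoactionMatrix (a : Matrix (Fin d) (Fin d) C) : Prop where
  mul : ∀ i j m, ∑ k, e.repr (e i * e j) k • a m k =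
    ∑ p, ∑ q, e.repr (e p * e q) m • (a p i * a q j)
  one : ∀ m, ∑ k, e.repr 1 k • a m k = e.repr 1 m • (1 : C)
  functional : ∀ j, ∑ i, τ (e i) • a i j = τ (e j) • (1 : C)

variable {e τ}

theorem IsCoactionMatrix.map {a : Matrix (Fin d) (Fin d) C} (ha : IsCoactionMatrix e τ a)
    (φ : C →ₐ[ℂ] D) : IsCoactionMatrix e τ (a.map φ) where
  mul i j m := by simpa using congrArg φ (ha.mul i j m)
  one m := by simpa using congrArg φ (ha.one m)
  functional j := by simpa using congrArg φ (ha.functional j)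

/-- The product matrix belongs to the composite of two coaction maps. The relations for `g` are
applied first, then those for `f`. With the two inclusions into `C ⊗ C` this leads to the
comultiplication. -/
theorem IsCoactionMatrix.prod {a : Matrix (Fin d) (Fin d) C} (ha : IsCoactionMatrix e τ a)
    (f g : C →ₐ[ℂ] D) (hfg : ∀ x y, Commute (f x) (g y)) :
    IsCoactionMatrix e τ (a.map f * a.map g) where
  mul i j m := by
    have h1 : ∀ s t, ∑ p, ∑ q, e.repr (e p * e q) m • (f (a p s) * f (a q t)) =
        ∑ k, e.repr (e s * e t) k • f (a m k) := fun s t => ((ha.map f).mul s t m).symm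
    have h2 : ∀ k, ∑ s, ∑ t, e.repr (e s * e t) k • (g (a s i) * g (a t j)) =
        ∑ l, e.repr (e i * e j) l • g (a k l) := fun k => ((ha.map g).mul i j k).symm
    simp only [Matrix.mul_apply, Matrix.map_apply]
    calc ∑ k, e.repr (e i * e j) k • ∑ l, f (a m l) * g (a l k)
        = ∑ l, f (a m l) * ∑ k, e.repr (e i * e j) k • g (a l k) := by
          simp only [Finset.smul_sum, Finset.mul_sum, mul_smul_comm]
          exact Finset.sum_comm
      _ = ∑ s, ∑ t, (∑ l, e.repr (e s * e t) l • f (a m l)) * (g (a s i) * g (a t j)) := by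
          simp only [← h2, Finset.mul_sum, Finset.sum_mul, mul_smul_comm, smul_mul_assoc]
          rw [Finset.sum_comm]
          exact Finset.sum_congr rfl fun s _ => Finset.sum_comm
      _ = ∑ s, ∑ t, ∑ p, ∑ q,
            e.repr (e p * e q) m • ((f (a p s) * g (a s i)) * (f (a q t) * g (a t j))) := by
          refine Finset.sum_congr rfl fun s _ => Finset.sum_congr rfl fun t _ => ?_
          rw [← h1]
          simp only [Finset.sum_mul, smul_mul_assoc]
          refine Finset.sum_congr rfl fun p _ => Finset.sum_congr rfl fun q _ => ?_
          congr 1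
          -- Commutation enters here, to move `g (a s i)` past `f (a q t)`.
          rw [mul_assoc, mul_assoc, ← mul_assoc (f (a q t)), (hfg _ _).eq, mul_assoc]
      _ = _ := by
          simp only [Finset.mul_sum, Finset.sum_mul, Finset.smul_sum]
          calc _ = ∑ s, ∑ p, ∑ t, ∑ q, e.repr (e p * e q) m •
                ((f (a p s) * g (a s i)) * (f (a q t) * g (a t j))) :=
              Finset.sum_congr rfl fun s _ => Finset.sum_comm
            _ = ∑ p, ∑ s, ∑ q, ∑ t, e.repr (e p * e q) m •
                ((f (a p s) * g (a s i)) * (f (a q t) * g (a t j))) := by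
              rw [Finset.sum_comm]
              exact Finset.sum_congr rfl fun p _ => Finset.sum_congr rfl fun s _ =>
                Finset.sum_comm
            _ = ∑ p, ∑ q, ∑ s, ∑ t, e.repr (e p * e q) m •
                ((f (a p s) * g (a s i)) * (f (a q t) * g (a t j))) :=
              Finset.sum_congr rfl fun p _ => Finset.sum_comm
            _ = _ := Finset.sum_congr rfl fun p _ => Finset.sum_congr rfl fun q _ =>
                Finset.sum_comm
  one m := by
    have h2 : ∀ l, ∑ k, e.repr 1 k • g (a l k) = e.repr 1 l • (1 : D) := (ha.map g).one
    have h1 : ∑ k, e.repr 1 k • f (a m k) = e.repr 1 m • (1 : D) := (ha.map f).one m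
    simp only [Matrix.mul_apply, Matrix.map_apply, Finset.smul_sum]
    rw [Finset.sum_comm, ← h1]
    refine Finset.sum_congr rfl fun l _ => ?_
    simp only [← mul_smul_comm]
    rw [← Finset.mul_sum, h2, mul_smul_comm, mul_one]
  functional j := by
    have h1 : ∀ l, ∑ i, τ (e i) • f (a i l) = τ (e l) • (1 : D) := (ha.map f).functional
    have h2 : ∑ i, τ (e i) • g (a i j) = τ (e j) • (1 : D) := (ha.map g).functional j
    simp only [Matrix.mul_apply, Matrix.map_apply, Finset.smul_sum]
    rw [Finset.sum_comm, ← h2]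
    refine Finset.sum_congr rfl fun l _ => ?_
    simp only [← smul_mul_assoc]
    rw [← Finset.sum_mul, h1, smul_mul_assoc, one_mul]

variable (e τ)

/-- Two sequences of matrices that behave like `a k = S²ᵏ(u)` and `b k = S²ᵏ⁺¹(u)` for the matrix
`u` of a `τ`-preserving coaction of a Hopf algebra with invertible antipode `S`. -/
structure IsAntipodalSequence (a b : ℤ → Matrix (Fin d) (Fin d) C) : Prop where
  mul_left : ∀ k, a k * b k = 1
  mul_right : ∀ k, b k * a k = 1
  -- An antipode reverses products, so the image of `a k * b k = 1` under `S` is a relation over the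
  -- opposite algebra.
  op_mul_left : ∀ k, (b k).map op * (a (k + 1)).map op = 1
  op_mul_right : ∀ k, (a (k + 1)).map op * (b k).map op = 1
  coaction : ∀ k, IsCoactionMatrix e τ (a k)
  op_coaction : ∀ k, IsCoactionMatrix e τ ((b k).map op)

variable {e τ}

theorem Matrix.map_ringHom_mul_eq_one {R S : Type*} [Ring R] [Ring S]
    (φ : R →+* S) {x y : Matrix (Fin d) (Fin d) R} (h : x * y = 1) : x.map φ * y.map φ = 1 := by
  rw [← Matrix.map_mul, h, Matrix.map_one _ (map_zero φ) (map_one φ)]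

theorem IsAntipodalSequence.map {a b : ℤ → Matrix (Fin d) (Fin d) C}
    (h : IsAntipodalSequence e τ a b) (φ : C →ₐ[ℂ] D) :
    IsAntipodalSequence e τ (fun k => (a k).map φ) (fun k => (b k).map φ) where
  mul_left k := Matrix.map_ringHom_mul_eq_one (φ : C →+* D) (h.mul_left k)
  mul_right k := Matrix.map_ringHom_mul_eq_one (φ : C →+* D) (h.mul_right k)
  op_mul_left k :=
    Matrix.map_ringHom_mul_eq_one (RingHom.op (φ : C →+* D)) (h.op_mul_left k)
  op_mul_right k :=
    Matrix.map_ringHom_mul_eq_one (RingHom.op (φ : C →+* D)) (h.op_mul_right k)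
  coaction k := (h.coaction k).map φ
  op_coaction k := (h.op_coaction k).map (AlgHom.op φ)

theorem matrix_eq_of_forall_map_eq {R : Type*} {ι : Type*} {S : ι → Type*}
    (φ : ∀ i, R → S i) (hφ : ∀ x y, (∀ i, φ i x = φ i y) → x = y)
    {x y : Matrix (Fin d) (Fin d) R} (h : ∀ i, x.map (φ i) = y.map (φ i)) : x = y :=
  Matrix.ext fun p q => hφ _ _ fun i => congrFun (congrFun (h i) p) q

theorem IsCoactionMatrix.of_forall_map {ι : Type*} {S : ι → Type*} [∀ i, Ring (S i)]
    [∀ i, Algebra ℂ (S i)] (φ : ∀ i, C →ₐ[ℂ] S i) (hφ : ∀ x y, (∀ i, φ i x = φ i y) → x = y)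
    {a : Matrix (Fin d) (Fin d) C} (h : ∀ i, IsCoactionMatrix e τ (a.map (φ i))) :
    IsCoactionMatrix e τ a where
  mul i j m := hφ _ _ fun t => by simpa using (h t).mul i j m
  one m := hφ _ _ fun t => by simpa using (h t).one m
  functional j := hφ _ _ fun t => by simpa using (h t).functional j

/-- All conditions are equations, so a jointly injective family of homomorphisms detects them. This
lets the universal algebra be defined without an explicit list of relations. -/
theorem IsAntipodalSequence.of_forall_map {ι : Type*} {S : ι → Type*} [∀ i, Ring (S i)]
    [∀ i, Algebra ℂ (S i)] (φ : ∀ i, C →ₐ[ℂ] S i) (hφ : ∀ x y, (∀ i, φ i x = φ i y) → x = y)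
    {a b : ℤ → Matrix (Fin d) (Fin d) C}
    (h : ∀ i, IsAntipodalSequence e τ (fun k => (a k).map (φ i)) (fun k => (b k).map (φ i))) :
    IsAntipodalSequence e τ a b := by
  have hφ' : ∀ x y : Cᵐᵒᵖ, (∀ i, AlgHom.op (φ i) x = AlgHom.op (φ i) y) → x = y := fun x y h =>
    MulOpposite.unop_injective (hφ _ _ fun i => MulOpposite.op_injective (h i))
  have key : ∀ {R : Type _} [Ring R] [Algebra ℂ R] {T : ι → Type _} [∀ i, Ring (T i)]
      [∀ i, Algebra ℂ (T i)] (ψ : ∀ i, R →ₐ[ℂ] T i) (hψ : ∀ x y, (∀ i, ψ i x = ψ i y) → x = y)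
      {x y : Matrix (Fin d) (Fin d) R} (h : ∀ i, x.map (ψ i) * y.map (ψ i) = 1), x * y = 1 := by
    intro R _ _ T _ _ ψ hψ x y h
    refine matrix_eq_of_forall_map_eq (fun i => ψ i) hψ fun i => ?_
    rw [Matrix.map_mul, h, Matrix.map_one _ (map_zero _) (map_one _)]
  exact
  { mul_left := fun k => key φ hφ fun i => (h i).mul_left k
    mul_right := fun k => key φ hφ fun i => (h i).mul_right k
    op_mul_left := fun k => key (fun i => AlgHom.op (φ i)) hφ' fun i => (h i).op_mul_left k
    op_mul_right := fun k => key (fun i => AlgHom.op (φ i)) hφ' fun i => (h i).op_mul_right k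
    coaction := fun k => IsCoactionMatrix.of_forall_map φ hφ fun i => (h i).coaction k
    op_coaction := fun k => IsCoactionMatrix.of_forall_map (fun i => AlgHom.op (φ i)) hφ'
      fun i => (h i).op_coaction k }

end CoactionMatrix

/-- Generators of the universal algebra carrying two sequences of `d × d` matrices. -/
inductive SequenceGenerator (d : ℕ) : Type v
  | a (k : ℤ) (i j : Fin d)
  | b (k : ℤ) (i j : Fin d)

namespace SequenceGenerator

variable {d : ℕ} {C : Type*}

/-- The value of a generator in a pair of sequences of matrices. -/
def eval (x y : ℤ → Matrix (Fin d) (Fin d) C) : SequenceGenerator.{v} d → C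
  | a k i j => x k i j
  | b k i j => y k i j

end SequenceGenerator

/-! ### The universal algebra and the epimorphism property of `a 0`. -/

section UniversalAlgebra

variable {B : Type u} [Ring B] [Algebra ℂ B] {d : ℕ} (e : Module.Basis (Fin d) ℂ B)
  (τ : B →ₗ[ℂ] ℂ)

/-- The relations that hold in all antipodal sequences. -/
def sequenceRel (x y : FreeAlgebra ℂ (SequenceGenerator.{v} d)) : Prop :=
  ∀ (C : Type v) [Ring C] [Algebra ℂ C] (a b : ℤ → Matrix (Fin d) (Fin d) C),
    IsAntipodalSequence e τ a b →
      FreeAlgebra.lift ℂ (SequenceGenerator.eval a b) x =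
        FreeAlgebra.lift ℂ (SequenceGenerator.eval a b) y

/-- The universal algebra carrying an antipodal sequence. -/
def UniversalAlgebra : Type v := RingQuot (sequenceRel.{u, v} e τ)

namespace UniversalAlgebra

instance : Ring (UniversalAlgebra.{u, v} e τ) :=
  inferInstanceAs (Ring (RingQuot (sequenceRel.{u, v} e τ)))

instance : Algebra ℂ (UniversalAlgebra.{u, v} e τ) :=
  inferInstanceAs (Algebra ℂ (RingQuot (sequenceRel.{u, v} e τ)))

/-- The quotient map from the free algebra. -/
def mk : FreeAlgebra ℂ (SequenceGenerator.{v} d) →ₐ[ℂ] UniversalAlgebra.{u, v} e τ :=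
  RingQuot.mkAlgHom ℂ (sequenceRel.{u, v} e τ)

theorem mk_surjective : Function.Surjective (mk.{u, v} e τ) :=
  RingQuot.mkAlgHom_surjective ℂ (sequenceRel.{u, v} e τ)

/-- The first sequence of matrices. -/
def a (k : ℤ) : Matrix (Fin d) (Fin d) (UniversalAlgebra.{u, v} e τ) :=
  .of fun i j => mk e τ (FreeAlgebra.ι ℂ (.a k i j))

/-- The second sequence of matrices. -/
def b (k : ℤ) : Matrix (Fin d) (Fin d) (UniversalAlgebra.{u, v} e τ) :=
  .of fun i j => mk e τ (FreeAlgebra.ι ℂ (.b k i j))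

variable {e τ}

/-- The homomorphism attached to an antipodal sequence. -/
def lift {C : Type v} [Ring C] [Algebra ℂ C] {x y : ℤ → Matrix (Fin d) (Fin d) C}
    (h : IsAntipodalSequence e τ x y) : UniversalAlgebra.{u, v} e τ →ₐ[ℂ] C :=
  RingQuot.liftAlgHom ℂ ⟨FreeAlgebra.lift ℂ (SequenceGenerator.eval x y),
    fun _ _ hr => hr C x y h⟩

section

variable {C : Type v} [Ring C] [Algebra ℂ C] {x y : ℤ → Matrix (Fin d) (Fin d) C}
  (h : IsAntipodalSequence e τ x y)

theorem lift_mk (t : FreeAlgebra ℂ (SequenceGenerator.{v} d)) :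
    lift h (mk e τ t) = FreeAlgebra.lift ℂ (SequenceGenerator.eval x y) t :=
  RingQuot.liftAlgHom_mkAlgHom_apply ℂ _ _ t

@[simp] theorem lift_a (k : ℤ) (i j : Fin d) : lift h (a e τ k i j) = x k i j :=
  (lift_mk h _).trans (FreeAlgebra.lift_ι_apply _ _)

@[simp] theorem lift_b (k : ℤ) (i j : Fin d) : lift h (b e τ k i j) = y k i j :=
  (lift_mk h _).trans (FreeAlgebra.lift_ι_apply _ _)

end

/-- Elements with equal images under every `lift` come from words related by `sequenceRel`, so the
lifts separate points; each lift sends the generators to an antipodal sequence. -/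
theorem isAntipodalSequence : IsAntipodalSequence e τ (a.{u, v} e τ) (b.{u, v} e τ) := by
  let ι := Σ' (C : Type v) (_ : Ring C) (_ : Algebra ℂ C) (x y : ℤ → Matrix (Fin d) (Fin d) C),
    IsAntipodalSequence e τ x y
  let : ∀ i : ι, Ring i.1 := fun i => i.2.1
  let : ∀ i : ι, Algebra ℂ i.1 := fun i => i.2.2.1
  refine IsAntipodalSequence.of_forall_map (S := fun i : ι => i.1)
    (fun i : ι => lift (C := i.1) i.2.2.2.2.2) (fun x y hxy => ?_) fun i => ?_
  · obtain ⟨x, rfl⟩ := mk_surjective e τ x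
    obtain ⟨y, rfl⟩ := mk_surjective e τ y
    refine RingQuot.mkAlgHom_rel ℂ fun C _ _ x' y' h => ?_
    rw [← lift_mk h, ← lift_mk h]
    exact hxy ⟨C, _, _, x', y', h⟩
  · obtain ⟨C, _, _, x, y, h⟩ := i
    convert h using 2
    · exact Matrix.ext fun _ _ => lift_a h _ _ _
    · exact Matrix.ext fun _ _ => lift_b h _ _ _

theorem induction {P : UniversalAlgebra.{u, v} e τ → Prop}
    (algebraMap : ∀ c : ℂ, P (algebraMap ℂ _ c)) (a : ∀ k i j, P (a e τ k i j))
    (b : ∀ k i j, P (b e τ k i j)) (add : ∀ x y, P x → P y → P (x + y))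
    (mul : ∀ x y, P x → P y → P (x * y)) (x : UniversalAlgebra.{u, v} e τ) : P x := by
  obtain ⟨x, rfl⟩ := mk_surjective e τ x
  induction x using FreeAlgebra.induction with
  | grade0 c => rw [AlgHom.commutes]; exact algebraMap c
  | grade1 g =>
    cases g with
    | a k i j => exact a k i j
    | b k i j => exact b k i j
  | mul x y hx hy => rw [map_mul]; exact mul _ _ hx hy
  | add x y hx hy => rw [map_add]; exact add _ _ hx hy

/-- The entries of the matrix `a 0` generate the universal algebra in the sense of epimorphisms,
because all other generators are entries of iterated inverses of this matrix. -/
theorem ringHom_ext {C : Type*} [Ring C] {f g : UniversalAlgebra.{u, v} e τ →+* C}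
    (h₀ : ∀ c : ℂ, f (algebraMap ℂ _ c) = g (algebraMap ℂ _ c))
    (h₁ : ∀ i j, f (a e τ 0 i j) = g (a e τ 0 i j)) : f = g := by
  have hs := isAntipodalSequence.{u, v} (e := e) (τ := τ)
  -- Inverses are unique, so agreement on `a k` and on `b k` are equivalent; `hba` repeats this over
  -- the opposite ring for `b k` and `a (k + 1)`. Equivalences allow induction in both directions of
  -- `ℤ`.
  have hab : ∀ k, (a e τ k).map f = (a e τ k).map g ↔ (b e τ k).map f = (b e τ k).map g := by
    intro k
    have l := fun φ : UniversalAlgebra.{u, v} e τ →+* C =>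
      Matrix.map_ringHom_mul_eq_one φ (hs.mul_left k)
    have r := fun φ : UniversalAlgebra.{u, v} e τ →+* C =>
      Matrix.map_ringHom_mul_eq_one φ (hs.mul_right k)
    exact ⟨fun h => left_inv_eq_right_inv (r f) (h ▸ l g),
      fun h => left_inv_eq_right_inv (l f) (h ▸ r g)⟩
  have hba : ∀ k, (b e τ k).map f = (b e τ k).map g ↔
      (a e τ (k + 1)).map f = (a e τ (k + 1)).map g := by
    intro k
    have l := fun φ : UniversalAlgebra.{u, v} e τ →+* C =>
      Matrix.map_ringHom_mul_eq_one (RingHom.op φ) (hs.op_mul_left k)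
    have r := fun φ : UniversalAlgebra.{u, v} e τ →+* C =>
      Matrix.map_ringHom_mul_eq_one (RingHom.op φ) (hs.op_mul_right k)
    have hop : ∀ x : Matrix (Fin d) (Fin d) (UniversalAlgebra.{u, v} e τ),
        x.map f = x.map g ↔ (x.map op).map (RingHom.op f) = (x.map op).map (RingHom.op g) := by
      intro x
      rw [← Matrix.ext_iff, ← Matrix.ext_iff]
      exact forall₂_congr fun i j => MulOpposite.op_injective.eq_iff.symm
    rw [hop, hop]
    exact ⟨fun h => left_inv_eq_right_inv (r f) (h ▸ l g),
      fun h => left_inv_eq_right_inv (l f) (h ▸ r g)⟩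
  have ha : ∀ k, (a e τ k).map f = (a e τ k).map g := by
    intro k
    induction k using Int.induction_on with
    | zero => exact Matrix.ext h₁
    | succ k ih => rwa [← hba, ← hab]
    | pred k ih =>
      rw [hab, hba]
      rwa [sub_add_cancel]
  refine RingHom.ext fun x => ?_
  induction x using induction with
  | algebraMap c => exact h₀ c
  | a k i j => exact congrFun (congrFun (ha k) i) j
  | b k i j => exact congrFun (congrFun ((hab k).1 (ha k)) i) j
  | add x y hx hy => rw [map_add, map_add, hx, hy]
  | mul x y hx hy => rw [map_mul, map_mul, hx, hy]

/-- The linear case; the version for ring homomorphisms is kept for the conjugate-linear involution.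
-/
theorem algHom_ext {C : Type*} [Ring C] [Algebra ℂ C] {f g : UniversalAlgebra.{u, v} e τ →ₐ[ℂ] C}
    (h : ∀ i j, f (a e τ 0 i j) = g (a e τ 0 i j)) : f = g :=
  AlgHom.coe_ringHom_injective (ringHom_ext (fun c => by simp) h)

end UniversalAlgebra

end UniversalAlgebra

/-! ## The Hopf `*`-algebra structure of the universal algebra -/

section Sequences

variable {B : Type u} [Ring B] [Algebra ℂ B] {d : ℕ} {e : Module.Basis (Fin d) ℂ B}
  {τ : B →ₗ[ℂ] ℂ} {C D : Type*} [Ring C] [Algebra ℂ C] [Ring D] [Algebra ℂ D]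

theorem IsCoactionMatrix.one_matrix :
    IsCoactionMatrix e τ (1 : Matrix (Fin d) (Fin d) C) where
  mul i j m := by simp [Matrix.one_apply]
  one m := by simp [Matrix.one_apply]
  functional j := by simp [Matrix.one_apply]

theorem map_op_mul_map_op {R S : Type*} [Ring R] [Ring S] {f g : R → S}
    (hfg : ∀ x y, Commute (f x) (g y)) (x : Matrix (Fin d) (Fin d) R) :
    (x.map f * x.map g).map op =
      (x.map op).map (fun z => op (f (unop z))) * (x.map op).map (fun z => op (g (unop z))) := by
  refine Matrix.ext fun i j => ?_
  simp only [Matrix.map_apply, Matrix.mul_apply, MulOpposite.unop_op, Finset.op_sum]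
  exact Finset.sum_congr rfl fun l _ => congrArg op (hfg _ _).eq

/-- Source of the comultiplication. The factors of the second sequence are swapped because the
inverse of `f(a) g(a)` is `g(b) f(b)`. -/
theorem IsAntipodalSequence.prod {a b : ℤ → Matrix (Fin d) (Fin d) C}
    (h : IsAntipodalSequence e τ a b) (f g : C →ₐ[ℂ] D) (hfg : ∀ x y, Commute (f x) (g y)) :
    IsAntipodalSequence e τ (fun k => (a k).map f * (a k).map g)
      (fun k => (b k).map g * (b k).map f) := by
  have hgf : ∀ x y, Commute (g x) (f y) := fun x y => (hfg y x).symm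
  have key : ∀ {R : Type _} [Ring R] {w x y z : Matrix (Fin d) (Fin d) R}, x * y = 1 → w * z = 1 →
      w * x * (y * z) = 1 := by
    intro R _ w x y z h1 h2
    rw [mul_assoc, ← mul_assoc x, h1, one_mul, h2]
  have hf := h.map f
  have hg := h.map g
  refine ⟨fun k => key (hg.mul_left k) (hf.mul_left k),
    fun k => key (hf.mul_right k) (hg.mul_right k), fun k => ?_, fun k => ?_,
    fun k => (h.coaction k).prod f g hfg, fun k => ?_⟩
  · rw [map_op_mul_map_op hfg, map_op_mul_map_op hgf]
    exact key (hf.op_mul_left k) (hg.op_mul_left k)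
  · rw [map_op_mul_map_op hfg, map_op_mul_map_op hgf]
    exact key (hg.op_mul_right k) (hf.op_mul_right k)
  · rw [map_op_mul_map_op hgf]
    exact (h.op_coaction k).prod (AlgHom.op g) (AlgHom.op f) fun x y =>
      MulOpposite.commute_op.2 (hgf _ _)

/-- Source of the antipode, which shifts `Sⁿ(u)` to `Sⁿ⁺¹(u)`: `a k` goes to `b k`, and `b k` to `a
(k + 1)`. -/
theorem IsAntipodalSequence.opposite {a b : ℤ → Matrix (Fin d) (Fin d) C}
    (h : IsAntipodalSequence e τ a b) :
    IsAntipodalSequence e τ (fun k => (b k).map op) (fun k => (a (k + 1)).map op) where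
  mul_left := h.op_mul_left
  mul_right := h.op_mul_right
  op_mul_left k := Matrix.map_ringHom_mul_eq_one (RingEquiv.opOp C : C →+* Cᵐᵒᵖᵐᵒᵖ) (h.mul_left (k + 1))
  op_mul_right k :=
    Matrix.map_ringHom_mul_eq_one (RingEquiv.opOp C : C →+* Cᵐᵒᵖᵐᵒᵖ) (h.mul_right (k + 1))
  coaction := h.op_coaction
  op_coaction k := (h.coaction (k + 1)).map (AlgEquiv.opOp ℂ C : C →ₐ[ℂ] Cᵐᵒᵖᵐᵒᵖ)

variable (e τ) in
theorem isAntipodalSequence_one :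
    IsAntipodalSequence e τ (1 : ℤ → Matrix (Fin d) (Fin d) C) 1 := by
  have h1 : (1 : Matrix (Fin d) (Fin d) C).map op = 1 := Matrix.map_one _ rfl rfl
  constructor <;> intro k <;> simp only [Pi.one_apply, h1, mul_one]
  · exact IsCoactionMatrix.one_matrix
  · exact IsCoactionMatrix.one_matrix

variable [StarRing B] [StarModule ℂ B]

variable (e τ) in
/-- A basis of self-adjoint elements on which the functional `τ` takes real values. -/
class IsSelfAdjointBasis : Prop where
  star_basis : ∀ i, star (e i) = e i
  star_functional : ∀ i, star (τ (e i)) = τ (e i)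

variable (τ) in
theorem IsSelfAdjointBasis.repr_star [IsSelfAdjointBasis e τ] (x : B) (i : Fin d) :
    e.repr (star x) i = star (e.repr x i) := by
  conv_lhs => rw [← e.sum_repr x]
  simp only [star_sum, star_smul, IsSelfAdjointBasis.star_basis τ]
  exact congrFun (e.repr_sum_self fun j => star (e.repr x j)) i

/-- In a self-adjoint basis, conjugating the structure constants of `e i * e j` gives those of `e j
* e i`. This swap compensates the reversal of products by the antimultiplicative, conjugate-linear
map `unop ∘ f`. -/
theorem IsCoactionMatrix.map_conj [IsSelfAdjointBasis e τ] {a : Matrix (Fin d) (Fin d) C}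
    (ha : IsCoactionMatrix e τ a) (f : C →+* Dᵐᵒᵖ) (hf : ∀ c : ℂ, f (algebraMap ℂ C c) =
      op (algebraMap ℂ D (star c))) : IsCoactionMatrix e τ (a.map fun x => unop (f x)) := by
  have hs : ∀ (c : ℂ) x, unop (f (c • x)) = star c • unop (f x) := by
    intro c x
    rw [Algebra.smul_def, map_mul, hf, MulOpposite.unop_mul, MulOpposite.unop_op,
      ← Algebra.commutes, Algebra.smul_def]
  have hc := IsSelfAdjointBasis.repr_star (e := e) τ
  have hb := IsSelfAdjointBasis.star_basis (e := e) τ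
  have hm : ∀ i j k, star (e.repr (e i * e j) k) = e.repr (e j * e i) k := by
    intro i j k
    rw [← hc, star_mul, hb, hb]
  refine ⟨fun i j m => ?_, fun m => ?_, fun j => ?_⟩
  · have := congrArg (fun x => unop (f x)) (ha.mul j i m)
    simp only [map_sum, Finset.unop_sum, hs, hm, map_mul, MulOpposite.unop_mul] at this
    simp only [Matrix.map_apply]
    rw [this]
    exact Finset.sum_comm
  · have := congrArg (fun x => unop (f x)) (ha.one m)
    simp only [map_sum, Finset.unop_sum, hs, map_one, MulOpposite.unop_one, ← hc, star_one] at this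
    exact this
  · have := congrArg (fun x => unop (f x)) (ha.functional j)
    simp only [map_sum, Finset.unop_sum, hs, map_one, MulOpposite.unop_one,
      IsSelfAdjointBasis.star_functional] at this
    exact this

end Sequences

/-- A complex algebra with the conjugate scalar multiplication. -/
def ConjAlgebra (C : Type v) : Type v := C

namespace ConjAlgebra

variable (C : Type v) [Ring C] [Algebra ℂ C]

instance : Ring (ConjAlgebra C) := inferInstanceAs (Ring C)

instance : Algebra ℂ (ConjAlgebra C) :=
  RingHom.toAlgebra' (S := ConjAlgebra C) ((algebraMap ℂ C).comp (starRingEnd ℂ))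
    fun c x => Algebra.commutes (A := C) (starRingEnd ℂ c) x

theorem algebraMap_apply (c : ℂ) :
    algebraMap ℂ (ConjAlgebra C) c = (algebraMap ℂ C (star c) : C) := rfl

/-- The conjugate algebra has the same underlying ring. -/
def ringEquiv : ConjAlgebra C ≃+* C := RingEquiv.refl C

end ConjAlgebra

section ConjSequence

variable {B : Type u} [Ring B] [Algebra ℂ B] [StarRing B] [StarModule ℂ B] {d : ℕ}
  {e : Module.Basis (Fin d) ℂ B} {τ : B →ₗ[ℂ] ℂ} [IsSelfAdjointBasis e τ]
  {C : Type v} [Ring C] [Algebra ℂ C]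

/-- Source of the involution. For self-adjoint `u` one has `Sⁿ(u)* = S⁻ⁿ(u)`, so `a k = S²ᵏ(u)` goes
to `a (-k)`, and `b k = S²ᵏ⁺¹(u)` to `b (-k - 1)` since `-(2k + 1) = 2(-k - 1) + 1`. -/
theorem IsAntipodalSequence.conj {a b : ℤ → Matrix (Fin d) (Fin d) C}
    (h : IsAntipodalSequence e τ a b) :
    IsAntipodalSequence e τ
      (fun k => (a (-k)).map (fun x => (MulOpposite.op x : (ConjAlgebra C)ᵐᵒᵖ)))
      (fun k => (b (-k - 1)).map (fun x => (MulOpposite.op x : (ConjAlgebra C)ᵐᵒᵖ))) where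
  mul_left k := by
    have := h.op_mul_right (-k - 1)
    rwa [sub_add_cancel] at this
  mul_right k := by
    have := h.op_mul_left (-k - 1)
    rwa [sub_add_cancel] at this
  op_mul_left k := by
    have := Matrix.map_ringHom_mul_eq_one (RingEquiv.opOp C : C →+* Cᵐᵒᵖᵐᵒᵖ) (h.mul_right (-k - 1))
    rw [neg_add']
    exact this
  op_mul_right k := by
    have := Matrix.map_ringHom_mul_eq_one (RingEquiv.opOp C : C →+* Cᵐᵒᵖᵐᵒᵖ) (h.mul_left (-k - 1))
    rw [neg_add']
    exact this
  coaction k := (h.coaction (-k)).map_conj (D := (ConjAlgebra C)ᵐᵒᵖ)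
    (RingEquiv.opOp C : C →+* Cᵐᵒᵖᵐᵒᵖ) fun c => by
      change MulOpposite.op (MulOpposite.op (algebraMap ℂ C c)) =
        MulOpposite.op (MulOpposite.op (algebraMap ℂ C (star (star c))))
      rw [star_star]
  op_coaction k := (h.op_coaction (-k - 1)).map_conj (D := (ConjAlgebra C)ᵐᵒᵖᵐᵒᵖ)
    (RingEquiv.opOp Cᵐᵒᵖ : Cᵐᵒᵖ →+* Cᵐᵒᵖᵐᵒᵖᵐᵒᵖ) fun c => by
      change MulOpposite.op (MulOpposite.op (MulOpposite.op (algebraMap ℂ C c))) =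
        MulOpposite.op (MulOpposite.op (MulOpposite.op (algebraMap ℂ C (star (star c)))))
      rw [star_star]

end ConjSequence

/-! ### Structure maps on the generators. -/

namespace UniversalAlgebra

variable {B : Type u} [Ring B] [Algebra ℂ B] {d : ℕ} {e : Module.Basis (Fin d) ℂ B}
  {τ : B →ₗ[ℂ] ℂ}

theorem commute_includeLeft_includeRight {A : Type*} [Ring A] [Algebra ℂ A] (x y : A) :
    Commute (Algebra.TensorProduct.includeLeft (R := ℂ) (S := ℂ) (A := A) (B := A) x)
      (Algebra.TensorProduct.includeRight (R := ℂ) (A := A) (B := A) y) := by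
  simp [Commute, SemiconjBy]

variable (e τ)

/-- The comultiplication of the universal algebra. -/
def comulHom : UniversalAlgebra.{u, v} e τ →ₐ[ℂ]
    UniversalAlgebra.{u, v} e τ ⊗[ℂ] UniversalAlgebra.{u, v} e τ :=
  lift (isAntipodalSequence.prod Algebra.TensorProduct.includeLeft
    Algebra.TensorProduct.includeRight commute_includeLeft_includeRight)

/-- The counit of the universal algebra. -/
def counitHom : UniversalAlgebra.{u, v} e τ →ₐ[ℂ] ℂ :=
  -- `lift` has targets in `Type v`, so the counit passes through a copy of `ℂ` there.
  (ULift.algEquiv : ULift.{v} ℂ ≃ₐ[ℂ] ℂ).toAlgHom.comp (lift (isAntipodalSequence_one e τ))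

/-- The antipode of the universal algebra as a homomorphism to the opposite algebra. -/
def antipodeHom : UniversalAlgebra.{u, v} e τ →ₐ[ℂ] (UniversalAlgebra.{u, v} e τ)ᵐᵒᵖ :=
  lift isAntipodalSequence.opposite

variable {e τ}

theorem comulHom_a (k : ℤ) (i j : Fin d) :
    comulHom e τ (a.{u, v} e τ k i j) = ∑ l, a e τ k i l ⊗ₜ[ℂ] a e τ k l j := by
  simp [comulHom, Matrix.mul_apply]

theorem comulHom_b (k : ℤ) (i j : Fin d) :
    comulHom e τ (b.{u, v} e τ k i j) = ∑ l, b e τ k l j ⊗ₜ[ℂ] b e τ k i l := by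
  simp [comulHom, Matrix.mul_apply]

theorem counitHom_a (k : ℤ) (i j : Fin d) :
    counitHom e τ (a.{u, v} e τ k i j) = if i = j then 1 else 0 := by
  simp only [counitHom, AlgHom.comp_apply, lift_a, Pi.one_apply, Matrix.one_apply]
  split <;> rfl

theorem counitHom_b (k : ℤ) (i j : Fin d) :
    counitHom e τ (b.{u, v} e τ k i j) = if i = j then 1 else 0 := by
  simp only [counitHom, AlgHom.comp_apply, lift_b, Pi.one_apply, Matrix.one_apply]
  split <;> rfl

theorem antipodeHom_a (k : ℤ) (i j : Fin d) :
    antipodeHom e τ (a.{u, v} e τ k i j) = op (b e τ k i j) := lift_a _ _ _ _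

theorem antipodeHom_b (k : ℤ) (i j : Fin d) :
    antipodeHom e τ (b.{u, v} e τ k i j) = op (a e τ (k + 1) i j) := lift_b _ _ _ _

instance : Bialgebra ℂ (UniversalAlgebra.{u, v} e τ) :=
  Bialgebra.ofAlgHom (comulHom e τ) (counitHom e τ)
    (algHom_ext fun i j => by
      simp only [AlgHom.comp_apply, comulHom_a, map_sum, Algebra.TensorProduct.map_tmul,
        AlgHom.id_apply, TensorProduct.sum_tmul, TensorProduct.tmul_sum]
      rw [Finset.sum_comm]
      rfl)
    (algHom_ext fun i j => by
      simp [comulHom_a, counitHom_a, TensorProduct.ite_tmul])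
    (algHom_ext fun i j => by
      simp [comulHom_a, counitHom_a, TensorProduct.tmul_ite])

end UniversalAlgebra

/-! ### Propagating the antipode axiom along products. -/

section Antipode

variable {A : Type*} [Ring A] [Bialgebra ℂ A] (S : A →ₐ[ℂ] Aᵐᵒᵖ)

/-- The linear map underlying a homomorphism to the opposite algebra. -/
def unopLinearMap : A →ₗ[ℂ] A := (MulOpposite.opLinearEquiv ℂ).symm.toLinearMap ∘ₗ S.toLinearMap

theorem unopLinearMap_apply (x : A) : unopLinearMap S x = unop (S x) := rfl

theorem unopLinearMap_mul (x y : A) :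
    unopLinearMap S (x * y) = unopLinearMap S y * unopLinearMap S x := by
  simp [unopLinearMap_apply]

/-- In `S(y₁) S(x₁) x₂ y₂` the inner factor `S(x₁) x₂` is a scalar and can be pulled out. -/
theorem mul'_rTensor_mul (s t : A ⊗[ℂ] A) {c : ℂ}
    (hs : LinearMap.mul' ℂ A ((unopLinearMap S).rTensor A s) = algebraMap ℂ A c) :
    LinearMap.mul' ℂ A ((unopLinearMap S).rTensor A (s * t)) =
      c • LinearMap.mul' ℂ A ((unopLinearMap S).rTensor A t) := by
  have key : ∀ p q, LinearMap.mul' ℂ A ((unopLinearMap S).rTensor A (s * p ⊗ₜ[ℂ] q)) =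
      unopLinearMap S p * LinearMap.mul' ℂ A ((unopLinearMap S).rTensor A s) * q := by
    intro p q
    clear hs
    induction s with
    | zero => simp
    | add x y hx hy => simp only [add_mul, mul_add, map_add, hx, hy]
    | tmul x y => simp [unopLinearMap_mul, mul_assoc]
  induction t with
  | zero => simp
  | add x y hx hy => simp only [mul_add, map_add, hx, hy, smul_add]
  | tmul p q =>
    rw [key, hs, ← Algebra.commutes, mul_assoc, ← Algebra.smul_def]
    rfl

/-- Here `x₁ y₁ S(y₂) S(x₂)` collapses from the second factor, so the scalar condition is on `t`. -/
theorem mul'_lTensor_mul (s t : A ⊗[ℂ] A) {c : ℂ}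
    (ht : LinearMap.mul' ℂ A ((unopLinearMap S).lTensor A t) = algebraMap ℂ A c) :
    LinearMap.mul' ℂ A ((unopLinearMap S).lTensor A (s * t)) =
      c • LinearMap.mul' ℂ A ((unopLinearMap S).lTensor A s) := by
  have key : ∀ p q, LinearMap.mul' ℂ A ((unopLinearMap S).lTensor A (p ⊗ₜ[ℂ] q * t)) =
      p * LinearMap.mul' ℂ A ((unopLinearMap S).lTensor A t) * unopLinearMap S q := by
    intro p q
    clear ht
    induction t with
    | zero => simp
    | add x y hx hy => simp only [add_mul, mul_add, map_add, hx, hy]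
    | tmul x y => simp [unopLinearMap_mul, mul_assoc]
  induction s with
  | zero => simp
  | add x y hx hy => simp only [add_mul, map_add, hx, hy, smul_add]
  | tmul p q =>
    rw [key, ht, ← Algebra.commutes, mul_assoc, ← Algebra.smul_def]
    rfl

end Antipode

namespace UniversalAlgebra

variable {B : Type u} [Ring B] [Algebra ℂ B] {d : ℕ} {e : Module.Basis (Fin d) ℂ B}
  {τ : B →ₗ[ℂ] ℂ}

theorem comul_eq (x : UniversalAlgebra.{u, v} e τ) : comul (R := ℂ) x = comulHom e τ x := rfl

theorem counit_eq (x : UniversalAlgebra.{u, v} e τ) : counit (R := ℂ) x = counitHom e τ x := rfl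

theorem sum_b_mul_a (k : ℤ) (i j : Fin d) :
    ∑ l, b.{u, v} e τ k i l * a e τ k l j = if i = j then 1 else 0 := by
  rw [← Matrix.mul_apply, isAntipodalSequence.mul_right, Matrix.one_apply]

theorem sum_a_mul_b (k : ℤ) (i j : Fin d) :
    ∑ l, a.{u, v} e τ k i l * b e τ k l j = if i = j then 1 else 0 := by
  rw [← Matrix.mul_apply, isAntipodalSequence.mul_left, Matrix.one_apply]

theorem sum_a_succ_mul_b (k : ℤ) (i j : Fin d) :
    ∑ l, a.{u, v} e τ (k + 1) l j * b e τ k i l = if i = j then 1 else 0 := by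
  have := congrFun (congrFun (isAntipodalSequence.{u, v} (e := e) (τ := τ).op_mul_left k) i) j
  rw [Matrix.one_apply] at this
  apply MulOpposite.op_injective
  refine (Eq.trans ?_ this).trans (by split <;> rfl)
  simp [Matrix.mul_apply, Finset.op_sum]

theorem sum_b_mul_a_succ (k : ℤ) (i j : Fin d) :
    ∑ l, b.{u, v} e τ k l j * a e τ (k + 1) i l = if i = j then 1 else 0 := by
  have := congrFun (congrFun (isAntipodalSequence.{u, v} (e := e) (τ := τ).op_mul_right k) i) j
  rw [Matrix.one_apply] at this
  apply MulOpposite.op_injective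
  refine (Eq.trans ?_ this).trans (by split <;> rfl)
  simp [Matrix.mul_apply, Finset.op_sum]

/-- The convolution of `S` with the identity is not a priori multiplicative, so `algHom_ext` does
not apply: the axiom is checked on all generators and extended to products by `mul'_rTensor_mul` and
`mul'_lTensor_mul`. -/
instance : HopfAlgebra ℂ (UniversalAlgebra.{u, v} e τ) where
  antipode := unopLinearMap (antipodeHom e τ)
  mul_antipode_rTensor_comul := LinearMap.ext fun x => by
    simp only [LinearMap.comp_apply, Algebra.linearMap_apply, comul_eq, counit_eq]
    induction x using induction with
    | algebraMap c =>
      simp [unopLinearMap_apply, Algebra.TensorProduct.algebraMap_apply]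
    | a k i j =>
      simp only [comulHom_a, counitHom_a, map_sum, LinearMap.rTensor_tmul, LinearMap.mul'_apply,
        unopLinearMap_apply, antipodeHom_a, MulOpposite.unop_op, sum_b_mul_a]
      split <;> simp
    | b k i j =>
      simp only [comulHom_b, counitHom_b, map_sum, LinearMap.rTensor_tmul, LinearMap.mul'_apply,
        unopLinearMap_apply, antipodeHom_b, MulOpposite.unop_op, sum_a_succ_mul_b]
      split <;> simp
    | add x y hx hy => simp only [map_add, hx, hy]
    | mul x y hx hy =>
      rw [map_mul, mul'_rTensor_mul _ _ _ hx, hy, map_mul, map_mul, Algebra.smul_def]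
  mul_antipode_lTensor_comul := LinearMap.ext fun x => by
    simp only [LinearMap.comp_apply, Algebra.linearMap_apply, comul_eq, counit_eq]
    induction x using induction with
    | algebraMap c =>
      simp [unopLinearMap_apply, Algebra.TensorProduct.algebraMap_apply]
    | a k i j =>
      simp only [comulHom_a, counitHom_a, map_sum, LinearMap.lTensor_tmul, LinearMap.mul'_apply,
        unopLinearMap_apply, antipodeHom_a, MulOpposite.unop_op, sum_a_mul_b]
      split <;> simp
    | b k i j =>
      simp only [comulHom_b, counitHom_b, map_sum, LinearMap.lTensor_tmul, LinearMap.mul'_apply,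
        unopLinearMap_apply, antipodeHom_b, MulOpposite.unop_op, sum_b_mul_a_succ]
      split <;> simp
    | add x y hx hy => simp only [map_add, hx, hy]
    | mul x y hx hy =>
      rw [map_mul, mul'_lTensor_mul _ _ _ hy, hx, map_mul, map_mul, Algebra.smul_def,
        Algebra.commutes]

theorem antipode_eq (x : UniversalAlgebra.{u, v} e τ) :
    antipode ℂ x = unop (antipodeHom e τ x) := rfl

theorem antipode_a (k : ℤ) (i j : Fin d) : antipode ℂ (a.{u, v} e τ k i j) = b e τ k i j := by
  rw [antipode_eq, antipodeHom_a, MulOpposite.unop_op]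

theorem antipode_b (k : ℤ) (i j : Fin d) :
    antipode ℂ (b.{u, v} e τ k i j) = a e τ (k + 1) i j := by
  rw [antipode_eq, antipodeHom_b, MulOpposite.unop_op]

/-! ### The involution of the universal algebra. -/

section Star

variable [StarRing B] [StarModule ℂ B] [IsSelfAdjointBasis e τ]

variable (e τ) in
/-- The involution of the universal algebra as a homomorphism to the opposite ring. -/
def starHom : UniversalAlgebra.{u, v} e τ →+* (UniversalAlgebra.{u, v} e τ)ᵐᵒᵖ :=
  (RingEquiv.op (ConjAlgebra.ringEquiv (UniversalAlgebra.{u, v} e τ))).toRingHom.comp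
    (lift isAntipodalSequence.conj).toRingHom

theorem starHom_a (k : ℤ) (i j : Fin d) :
    starHom e τ (a.{u, v} e τ k i j) = op (a e τ (-k) i j) :=
  congrArg (RingEquiv.op (ConjAlgebra.ringEquiv (UniversalAlgebra.{u, v} e τ)))
    (lift_a (isAntipodalSequence.{u, v} (e := e) (τ := τ)).conj k i j)

theorem starHom_b (k : ℤ) (i j : Fin d) :
    starHom e τ (b.{u, v} e τ k i j) = op (b e τ (-k - 1) i j) :=
  congrArg (RingEquiv.op (ConjAlgebra.ringEquiv (UniversalAlgebra.{u, v} e τ)))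
    (lift_b (isAntipodalSequence.{u, v} (e := e) (τ := τ)).conj k i j)

theorem starHom_algebraMap (c : ℂ) :
    starHom e τ (algebraMap ℂ (UniversalAlgebra.{u, v} e τ) c) = op (algebraMap ℂ _ (star c)) :=
  congrArg (RingEquiv.op (ConjAlgebra.ringEquiv (UniversalAlgebra.{u, v} e τ)))
    (AlgHom.commutes (lift (isAntipodalSequence.{u, v} (e := e) (τ := τ)).conj) c)

theorem starHom_starHom (x : UniversalAlgebra.{u, v} e τ) :
    starHom e τ (unop (starHom e τ x)) = op x := by
  have h : (RingHom.op (starHom e τ)).comp (starHom e τ) =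
      (RingEquiv.opOp (UniversalAlgebra.{u, v} e τ)).toRingHom :=
    ringHom_ext (fun c => by simp [starHom_algebraMap]) fun i j => by simp [starHom_a]
  exact congrArg unop (RingHom.congr_fun h x)

instance : StarRing (UniversalAlgebra.{u, v} e τ) where
  star x := unop (starHom e τ x)
  star_involutive x := congrArg unop (starHom_starHom x)
  star_mul x y := by rw [map_mul, MulOpposite.unop_mul]
  star_add x y := by rw [map_add, MulOpposite.unop_add]

theorem star_eq (x : UniversalAlgebra.{u, v} e τ) : star x = unop (starHom e τ x) := rfl

theorem star_a (k : ℤ) (i j : Fin d) : star (a.{u, v} e τ k i j) = a e τ (-k) i j := by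
  rw [star_eq, starHom_a, MulOpposite.unop_op]

theorem star_b (k : ℤ) (i j : Fin d) : star (b.{u, v} e τ k i j) = b e τ (-k - 1) i j := by
  rw [star_eq, starHom_b, MulOpposite.unop_op]

theorem star_algebraMap (c : ℂ) :
    star (algebraMap ℂ (UniversalAlgebra.{u, v} e τ) c) = algebraMap ℂ _ (star c) := by
  rw [star_eq, starHom_algebraMap, MulOpposite.unop_op]

instance : StarModule ℂ (UniversalAlgebra.{u, v} e τ) where
  star_smul c x := by
    rw [Algebra.smul_def, star_mul, star_algebraMap, ← Algebra.commutes, ← Algebra.smul_def]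

instance : HopfStarAlgebra (UniversalAlgebra.{u, v} e τ) where
  comul_star x := by
    let f : UniversalAlgebra.{u, v} e τ →+*
        (UniversalAlgebra.{u, v} e τ ⊗[ℂ] UniversalAlgebra.{u, v} e τ)ᵐᵒᵖ :=
      { toFun := fun x => op (comulHom e τ (star x))
        map_one' := by simp
        map_mul' := by simp
        map_zero' := by simp
        map_add' := by simp }
    let g : UniversalAlgebra.{u, v} e τ →+*
        (UniversalAlgebra.{u, v} e τ ⊗[ℂ] UniversalAlgebra.{u, v} e τ)ᵐᵒᵖ :=
      { toFun := fun x => op (star (comulHom e τ x))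
        map_one' := by simp
        map_mul' := by simp
        map_zero' := by simp
        map_add' := by simp }
    have h : f = g := ringHom_ext
      (fun c => congrArg op (a₁ := comulHom e τ (star _)) (a₂ := star (comulHom e τ _))
        (by simp [star_algebraMap, Algebra.TensorProduct.algebraMap_apply]))
      (fun i j => congrArg op (a₁ := comulHom e τ (star _)) (a₂ := star (comulHom e τ _))
        (by simp [star_a, comulHom_a]))
    exact congrArg unop (RingHom.congr_fun h x)
  star_antipode_star_antipode x := by
    -- Four antimultiplicative maps compose to a ring homomorphism; the entries of `a 0` pass
    -- through `b 0`, `b (-1)` and `a 0` back to `a 0`.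
    let f : UniversalAlgebra.{u, v} e τ →+* UniversalAlgebra.{u, v} e τ :=
      { toFun := fun x => star (antipode ℂ (star (antipode ℂ x)))
        map_one' := by simp
        map_mul' := by simp [antipode_mul_antidistrib]
        map_zero' := by simp
        map_add' := by simp }
    have h : f = RingHom.id _ := ringHom_ext
      (fun c => by simp [f, Algebra.algebraMap_eq_smul_one])
      (fun i j => by simp [f, star_a, star_b, antipode_a, antipode_b])
    exact RingHom.congr_fun h x

end Star

end UniversalAlgebra

/-! ## Coactions in terms of matrices -/

section Coefficients

variable {B : Type u} [Ring B] [Algebra ℂ B] {d : ℕ} (e : Module.Basis (Fin d) ℂ B)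
  {τ : B →ₗ[ℂ] ℂ} {C : Type*} [Ring C] [Algebra ℂ C]

/-- The coefficients of an element of `B ⊗ C` with respect to a basis of `B`. -/
def tensorCoeff (i : Fin d) : B ⊗[ℂ] C →ₗ[ℂ] C :=
  (TensorProduct.lid ℂ C).toLinearMap ∘ₗ (e.coord i).rTensor C

@[simp] theorem tensorCoeff_tmul (i : Fin d) (x : B) (c : C) :
    tensorCoeff e i (x ⊗ₜ[ℂ] c) = e.repr x i • c := rfl

theorem sum_basis_tmul_tensorCoeff (t : B ⊗[ℂ] C) : ∑ i, e i ⊗ₜ[ℂ] tensorCoeff e i t = t := by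
  induction t with
  | zero => simp
  | add x y hx hy => simp only [map_add, TensorProduct.tmul_add, Finset.sum_add_distrib, hx, hy]
  | tmul x c =>
    simp only [tensorCoeff_tmul, ← TensorProduct.smul_tmul]
    rw [← TensorProduct.sum_tmul, e.sum_repr]

theorem tensorCoeff_sum (c : Fin d → C) (i : Fin d) :
    tensorCoeff e i (∑ j, e j ⊗ₜ[ℂ] c j) = c i := by
  simp [Finsupp.single_apply]

theorem tensorCoeff_ext {s t : B ⊗[ℂ] C} (h : ∀ i, tensorCoeff e i s = tensorCoeff e i t) :
    s = t := by
  rw [← sum_basis_tmul_tensorCoeff e s, ← sum_basis_tmul_tensorCoeff e t]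
  simp only [h]

/-- The matrix of coefficients of a linear map `B → B ⊗ C`. -/
def coeffMatrix (σ : B →ₗ[ℂ] B ⊗[ℂ] C) : Matrix (Fin d) (Fin d) C :=
  .of fun i j => tensorCoeff e i (σ (e j))

theorem apply_basis_eq_sum (σ : B →ₗ[ℂ] B ⊗[ℂ] C) (j : Fin d) :
    σ (e j) = ∑ i, e i ⊗ₜ[ℂ] coeffMatrix e σ i j := (sum_basis_tmul_tensorCoeff e _).symm

/-- Compare coefficients of `e m` in `σ(e i e j) = σ(e i) σ(e j)` and in `σ(1) = 1 ⊗ 1`. -/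
theorem isCoactionMatrix_coeffMatrix (σ : B →ₐ[ℂ] B ⊗[ℂ] C)
    (hσ : ∀ b, TensorProduct.lid ℂ C (τ.rTensor C (σ b)) = τ b • (1 : C)) :
    IsCoactionMatrix e τ (coeffMatrix e σ.toLinearMap) where
  mul i j m := by
    have h1 : σ (e i * e j) = ∑ k, e.repr (e i * e j) k • σ (e k) := by
      conv_lhs => rw [← e.sum_repr (e i * e j)]
      simp only [map_sum, map_smul]
    have h2 := map_mul σ (e i) (e j)
    rw [h1] at h2
    have h3 := congrArg (tensorCoeff e m) h2
    rw [map_sum] at h3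
    simp only [map_smul] at h3
    refine h3.trans ?_
    have h4 := apply_basis_eq_sum e σ.toLinearMap
    simp only [AlgHom.toLinearMap_apply] at h4
    rw [h4 i, h4 j, Finset.sum_mul_sum]
    simp
  one m := by
    have h1 : σ 1 = ∑ k, e.repr 1 k • σ (e k) := by
      conv_lhs => rw [← e.sum_repr 1]
      simp only [map_sum, map_smul]
    have h2 := congrArg (tensorCoeff e m) h1
    rw [map_one, Algebra.TensorProduct.one_def, map_sum] at h2
    simp only [map_smul] at h2
    exact h2.symm
  functional j := by
    have h4 := apply_basis_eq_sum e σ.toLinearMap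
    simp only [AlgHom.toLinearMap_apply] at h4
    rw [← hσ, h4 j]
    simp

variable {e}

/-- The linear map `e j ↦ ∑ i, e i ⊗ a i j`. -/
def matrixLinearMap (e : Module.Basis (Fin d) ℂ B) (a : Matrix (Fin d) (Fin d) C) :
    B →ₗ[ℂ] B ⊗[ℂ] C :=
  e.constr ℂ fun j => ∑ i, e i ⊗ₜ[ℂ] a i j

@[simp] theorem matrixLinearMap_basis (a : Matrix (Fin d) (Fin d) C) (j : Fin d) :
    matrixLinearMap e a (e j) = ∑ i, e i ⊗ₜ[ℂ] a i j := e.constr_basis ℂ _ j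

theorem matrixLinearMap_eq_sum (a : Matrix (Fin d) (Fin d) C) (x : B) :
    matrixLinearMap e a x = ∑ i, e i ⊗ₜ[ℂ] ∑ k, e.repr x k • a i k := by
  conv_lhs => rw [← e.sum_repr x]
  simp only [map_sum, map_smul, matrixLinearMap_basis, Finset.smul_sum, TensorProduct.tmul_sum,
    TensorProduct.tmul_smul]
  exact Finset.sum_comm

/-- The homomorphism `B → B ⊗ C` attached to a coaction matrix. -/
def IsCoactionMatrix.toAlgHom {a : Matrix (Fin d) (Fin d) C} (ha : IsCoactionMatrix e τ a) :
    B →ₐ[ℂ] B ⊗[ℂ] C :=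
  AlgHom.ofLinearMap (matrixLinearMap e a)
    (tensorCoeff_ext e fun m => by
      rw [matrixLinearMap_eq_sum, tensorCoeff_sum, ha.one, Algebra.TensorProduct.one_def,
        tensorCoeff_tmul])
    (by
      rw [LinearMap.map_mul_iff]
      refine e.ext fun i => e.ext fun j => tensorCoeff_ext e fun m => ?_
      change tensorCoeff e m (matrixLinearMap e a (e i * e j)) =
        tensorCoeff e m (matrixLinearMap e a (e i) * matrixLinearMap e a (e j))
      rw [matrixLinearMap_eq_sum, tensorCoeff_sum, ha.mul, matrixLinearMap_basis,
        matrixLinearMap_basis, Finset.sum_mul_sum]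
      simp)

theorem IsCoactionMatrix.toAlgHom_basis {a : Matrix (Fin d) (Fin d) C}
    (ha : IsCoactionMatrix e τ a) (j : Fin d) :
    ha.toAlgHom (e j) = ∑ i, e i ⊗ₜ[ℂ] a i j := matrixLinearMap_basis a j

end Coefficients

/-! ### The universal coaction. -/

namespace UniversalAlgebra

variable {B : Type u} [Ring B] [Algebra ℂ B] [StarRing B] [StarModule ℂ B] {d : ℕ}
  (e : Module.Basis (Fin d) ℂ B) (τ : B →ₗ[ℂ] ℂ) [IsSelfAdjointBasis e τ]

/-- The coaction of the universal algebra. -/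
def coaction : StarCoaction B (UniversalAlgebra.{u, v} e τ) where
  coact := ((isAntipodalSequence.{u, v} (e := e) (τ := τ)).coaction 0).toAlgHom
  coassoc b := by
    set ha := (isAntipodalSequence.{u, v} (e := e) (τ := τ)).coaction 0
    have h : (TensorProduct.assoc ℂ B _ _).toLinearMap ∘ₗ
        ha.toAlgHom.toLinearMap.rTensor _ ∘ₗ ha.toAlgHom.toLinearMap =
        (comul (R := ℂ)).lTensor B ∘ₗ ha.toAlgHom.toLinearMap := e.ext fun j => by
      simp only [LinearMap.comp_apply, AlgHom.toLinearMap_apply, ha.toAlgHom_basis, map_sum,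
        LinearMap.rTensor_tmul, LinearMap.lTensor_tmul, TensorProduct.sum_tmul, comul_eq,
        comulHom_a, TensorProduct.tmul_sum]
      exact Finset.sum_comm
    exact LinearMap.congr_fun h b
  counit_coact b := by
    set ha := (isAntipodalSequence.{u, v} (e := e) (τ := τ)).coaction 0
    have h : (TensorProduct.rid ℂ B).toLinearMap ∘ₗ
        (counit (R := ℂ) (A := UniversalAlgebra.{u, v} e τ)).lTensor B ∘ₗ
          ha.toAlgHom.toLinearMap = LinearMap.id := e.ext fun j => by
      simp [ha.toAlgHom_basis, counit_eq, counitHom_a]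
    exact LinearMap.congr_fun h b
  coact_star b := by
    set ha := (isAntipodalSequence.{u, v} (e := e) (τ := τ)).coaction 0
    -- Both the basis and the entries of `a 0` are self-adjoint; conjugate-linearity does the rest.
    have h : ∀ j, ha.toAlgHom (e j) = star (ha.toAlgHom (e j)) := by
      intro j
      rw [ha.toAlgHom_basis, star_sum]
      simp [IsSelfAdjointBasis.star_basis (e := e) τ, star_a]
    rw [← e.sum_repr b]
    simp only [star_sum, star_smul, map_sum, map_smul, IsSelfAdjointBasis.star_basis (e := e) τ,
      ← h]

theorem coaction_basis (j : Fin d) :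
    (coaction.{u, v} e τ).coact (e j) = ∑ i, e i ⊗ₜ[ℂ] a e τ 0 i j :=
  ((isAntipodalSequence.{u, v} (e := e) (τ := τ)).coaction 0).toAlgHom_basis j

theorem coaction_preserves : (coaction.{u, v} e τ).Preserves τ := by
  have h : (TensorProduct.lid ℂ _).toLinearMap ∘ₗ
      τ.rTensor _ ∘ₗ (coaction.{u, v} e τ).coact.toLinearMap =
      τ.smulRight (1 : UniversalAlgebra.{u, v} e τ) := e.ext fun j => by
    simp only [LinearMap.comp_apply, AlgHom.toLinearMap_apply, coaction_basis, map_sum,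
      LinearMap.rTensor_tmul, LinearMap.smulRight_apply]
    exact (isAntipodalSequence.coaction 0).functional j
  exact LinearMap.congr_fun h

end UniversalAlgebra

/-! ### The antipodal sequence of an arbitrary coaction. -/

section CoefficientsOfCoaction

variable {B : Type u} [Ring B] [Algebra ℂ B] [StarRing B] [StarModule ℂ B] {d : ℕ}
  (e : Module.Basis (Fin d) ℂ B) {τ : B →ₗ[ℂ] ℂ}
  {H : Type v} [Ring H] [HopfStarAlgebra H]

namespace StarCoaction

variable (σ : StarCoaction B H)

/-- The matrix of coefficients of a coaction. -/
def matrix : Matrix (Fin d) (Fin d) H := coeffMatrix e σ.coact.toLinearMap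

theorem coact_basis (j : Fin d) : σ.coact (e j) = ∑ i, e i ⊗ₜ[ℂ] σ.matrix e i j :=
  apply_basis_eq_sum e σ.coact.toLinearMap j

theorem comul_matrix (i j : Fin d) :
    comul (R := ℂ) (σ.matrix e i j) = ∑ l, σ.matrix e i l ⊗ₜ[ℂ] σ.matrix e l j := by
  have h := congrArg (tensorCoeff e i) (σ.coassoc (e j))
  rw [coact_basis] at h
  simp only [map_sum, LinearMap.rTensor_tmul, LinearMap.lTensor_tmul, AlgHom.toLinearMap_apply,
    coact_basis, TensorProduct.sum_tmul, TensorProduct.assoc_tmul] at h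
  simp only [← map_sum] at h
  rw [tensorCoeff_sum, Finset.sum_comm] at h
  simp only [← TensorProduct.tmul_sum] at h
  rw [tensorCoeff_sum] at h
  exact h.symm

theorem counit_matrix (i j : Fin d) :
    counit (R := ℂ) (σ.matrix e i j) = if i = j then 1 else 0 := by
  have h := congrArg (fun x => e.repr x i) (σ.counit_coact (e j))
  rw [coact_basis] at h
  simpa [Finsupp.single_apply, eq_comm] using h

theorem antipode_mul_matrix : (σ.matrix e).map (antipode ℂ) * σ.matrix e = 1 := by
  refine Matrix.ext fun i j => ?_
  have h := mul_antipode_rTensor_comul_apply (R := ℂ) (σ.matrix e i j)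
  rw [comul_matrix, counit_matrix] at h
  simp only [map_sum, LinearMap.rTensor_tmul, LinearMap.mul'_apply] at h
  rw [Matrix.mul_apply, Matrix.one_apply]
  refine h.trans ?_
  split <;> simp

theorem matrix_mul_antipode : σ.matrix e * (σ.matrix e).map (antipode ℂ) = 1 := by
  refine Matrix.ext fun i j => ?_
  have h := mul_antipode_lTensor_comul_apply (R := ℂ) (σ.matrix e i j)
  rw [comul_matrix, counit_matrix] at h
  simp only [map_sum, LinearMap.lTensor_tmul, LinearMap.mul'_apply] at h
  rw [Matrix.mul_apply, Matrix.one_apply]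
  refine h.trans ?_
  split <;> simp

theorem star_matrix [IsSelfAdjointBasis e τ] (i j : Fin d) :
    star (σ.matrix e i j) = σ.matrix e i j := by
  have h := congrArg (tensorCoeff e i) (σ.coact_star (e j))
  rw [IsSelfAdjointBasis.star_basis τ, coact_basis, star_sum] at h
  simp only [TensorProduct.star_tmul, IsSelfAdjointBasis.star_basis (e := e) τ] at h
  rw [tensorCoeff_sum, tensorCoeff_sum] at h
  exact h.symm

end StarCoaction

variable (H) in
/-- The square of the antipode of a Hopf `*`-algebra. -/
def antipodeSq : H ≃ₐ[ℂ] H :=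
  AlgEquiv.ofBijective
    (AlgHom.ofLinearMap (antipode ℂ ∘ₗ antipode ℂ) (by simp)
      (fun x y => by simp [antipode_mul_antidistrib]))
    (by
      -- The involution axiom provides the inverse `x ↦ S(x*)*`; invertibility permits negative
      -- powers of `S²`.
      have h : Function.Bijective (antipode ℂ : H → H) :=
        Function.bijective_iff_has_inverse.2 ⟨fun x => star (antipode ℂ (star x)),
          HopfStarAlgebra.star_antipode_star_antipode, fun x => by
            rw [FiniteDual.antipode_star_antipode, star_star]⟩
      exact h.comp h)

/-- The matrix `S(u)` inverts `u` by the antipode axiom. The antihomomorphism `S` turns this into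
the relations over the opposite algebra, and the automorphisms `S²ᵏ` carry everything to index `k`.
-/
theorem StarCoaction.isAntipodalSequence (σ : StarCoaction B H) (hσ : σ.Preserves τ) :
    IsAntipodalSequence e τ (fun k => (σ.matrix e).map (antipodeSq H ^ k : H ≃ₐ[ℂ] H))
      (fun k => ((σ.matrix e).map (antipode ℂ)).map (antipodeSq H ^ k : H ≃ₐ[ℂ] H)) := by
  have hu : IsCoactionMatrix e τ (σ.matrix e) := isCoactionMatrix_coeffMatrix e σ.coact hσ
  have hS : ∀ {x y : Matrix (Fin d) (Fin d) H}, x * y = 1 →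
      (x.map (antipode ℂ)).map op * (y.map (antipode ℂ)).map op = 1 := fun h =>
    Matrix.map_ringHom_mul_eq_one (antipodeAlgHomOp ℂ H : H →+* Hᵐᵒᵖ) h
  have hsucc : ∀ k : ℤ, (σ.matrix e).map (antipodeSq H ^ (k + 1) : H ≃ₐ[ℂ] H) =
      (((σ.matrix e).map (antipode ℂ)).map (antipode ℂ)).map (antipodeSq H ^ k : H ≃ₐ[ℂ] H) := by
    intro k
    rw [zpow_add_one]
    rfl
  refine ⟨fun k => ?_, fun k => ?_, fun k => ?_, fun k => ?_, fun k => ?_, fun k => ?_⟩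
  · exact Matrix.map_ringHom_mul_eq_one (antipodeSq H ^ k : H ≃ₐ[ℂ] H).toAlgHom.toRingHom
      (σ.matrix_mul_antipode e)
  · exact Matrix.map_ringHom_mul_eq_one (antipodeSq H ^ k : H ≃ₐ[ℂ] H).toAlgHom.toRingHom
      (σ.antipode_mul_matrix e)
  · rw [hsucc]
    exact Matrix.map_ringHom_mul_eq_one
      (RingHom.op (antipodeSq H ^ k : H ≃ₐ[ℂ] H).toAlgHom.toRingHom)
      (hS (σ.matrix_mul_antipode e))
  · rw [hsucc]
    exact Matrix.map_ringHom_mul_eq_one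
      (RingHom.op (antipodeSq H ^ k : H ≃ₐ[ℂ] H).toAlgHom.toRingHom)
      (hS (σ.antipode_mul_matrix e))
  · exact hu.map (antipodeSq H ^ k : H ≃ₐ[ℂ] H).toAlgHom
  · exact (hu.map (antipodeAlgHomOp ℂ H)).map
      (AlgHom.op (antipodeSq H ^ k : H ≃ₐ[ℂ] H).toAlgHom)

end CoefficientsOfCoaction

/-! ### The universal property. -/

namespace UniversalAlgebra

variable {B : Type u} [Ring B] [Algebra ℂ B] [StarRing B] [StarModule ℂ B] {d : ℕ}
  {e : Module.Basis (Fin d) ℂ B} {τ : B →ₗ[ℂ] ℂ} {H : Type v} [Ring H] [HopfStarAlgebra H]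

section

variable (σ : StarCoaction B H) (hσ : σ.Preserves τ)

variable (e) in
/-- The morphism from the universal algebra attached to a coaction. -/
def classify : UniversalAlgebra.{u, v} e τ →ₐc[ℂ] H :=
  BialgHom.ofAlgHom (lift (σ.isAntipodalSequence e hσ))
    (algHom_ext fun i j => by
      simp only [AlgHom.comp_apply, lift_a]
      exact (σ.counit_matrix e i j).trans (counitHom_a 0 i j).symm)
    (algHom_ext fun i j => by
      change Algebra.TensorProduct.map _ _ (comulHom e τ (a e τ 0 i j)) = comul (R := ℂ) (lift _ _)
      simp only [comulHom_a, map_sum, Algebra.TensorProduct.map_tmul, lift_a]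
      exact (σ.comul_matrix e i j).symm)

theorem classify_a (i j : Fin d) : classify e σ hσ (a e τ 0 i j) = σ.matrix e i j :=
  lift_a (σ.isAntipodalSequence e hσ) 0 i j

theorem classify_b (i j : Fin d) :
    classify e σ hσ (b e τ 0 i j) = antipode ℂ (σ.matrix e i j) :=
  lift_b (σ.isAntipodalSequence e hσ) 0 i j

variable [IsSelfAdjointBasis e τ]

/-- With opposite rings as targets, both conditions compare ring homomorphisms, so the entries of `a
0` suffice; there `*` is trivial on both sides. -/
theorem isHopfStarHom_classify : IsHopfStarHom (classify e σ hσ) where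
  map_antipode x := by
    let φ : UniversalAlgebra.{u, v} e τ →ₐ[ℂ] H := classify e σ hσ
    have h : (AlgHom.op φ).comp (antipodeHom e τ) = (antipodeAlgHomOp ℂ H).comp φ :=
      algHom_ext fun i j => by
        change op (classify e σ hσ (unop (antipodeHom e τ (a e τ 0 i j)))) =
          op (antipode ℂ (classify e σ hσ (a e τ 0 i j)))
        rw [antipodeHom_a, MulOpposite.unop_op, classify_a, classify_b]
    exact congrArg unop (AlgHom.congr_fun h x)
  map_star x := by
    let φ : UniversalAlgebra.{u, v} e τ →ₐ[ℂ] H := classify e σ hσ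
    have h : (RingHom.op φ.toRingHom).comp (starHom e τ) =
        (starRingEquiv : H ≃+* Hᵐᵒᵖ).toRingHom.comp φ.toRingHom :=
      ringHom_ext
        (fun c => by
          change op (φ (unop (starHom e τ (algebraMap ℂ _ c)))) = op (star (φ (algebraMap ℂ _ c)))
          rw [starHom_algebraMap, MulOpposite.unop_op, AlgHom.commutes, AlgHom.commutes,
            algebraMap_star_comm])
        fun i j => by
          change op (classify e σ hσ (unop (starHom e τ (a e τ 0 i j)))) =
            op (star (classify e σ hσ (a e τ 0 i j)))
          rw [starHom_a, MulOpposite.unop_op, neg_zero, classify_a, σ.star_matrix (τ := τ) e]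
    exact congrArg unop (RingHom.congr_fun h x)

end

variable (e τ) [IsSelfAdjointBasis e τ]

theorem map_coaction_eq_iff (σ : StarCoaction B H) (φ : UniversalAlgebra.{u, v} e τ →ₐc[ℂ] H) :
    (∀ m, TensorProduct.map LinearMap.id (φ : UniversalAlgebra.{u, v} e τ →ₗ[ℂ] H)
      ((coaction e τ).coact m) = σ.coact m) ↔ ∀ i j, φ (a e τ 0 i j) = σ.matrix e i j := by
  have h : ∀ j, TensorProduct.map LinearMap.id (φ : UniversalAlgebra.{u, v} e τ →ₗ[ℂ] H)
      ((coaction e τ).coact (e j)) = ∑ i, e i ⊗ₜ[ℂ] φ (a e τ 0 i j) := by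
    intro j
    rw [coaction_basis, map_sum]
    rfl
  constructor
  · intro H i j
    have h1 := H (e j)
    rw [h, σ.coact_basis] at h1
    simpa only [tensorCoeff_sum] using congrArg (tensorCoeff e i) h1
  · intro H
    have h2 : TensorProduct.map LinearMap.id (φ : UniversalAlgebra.{u, v} e τ →ₗ[ℂ] _) ∘ₗ
        (coaction e τ).coact.toLinearMap = σ.coact.toLinearMap := e.ext fun j => by
      simp only [LinearMap.comp_apply, AlgHom.toLinearMap_apply]
      rw [h, σ.coact_basis]
      simp only [H]
    exact LinearMap.congr_fun h2

/-- Intertwining prescribes a morphism on the entries of `a 0`, and `algHom_ext` then gives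
uniqueness. -/
theorem isQuantumAutGroup : IsQuantumAutGroup.{u, v} τ (coaction.{u, v} e τ) where
  preserves := coaction_preserves e τ
  initial H _ _ σ hσ := by
    refine ⟨classify e σ hσ, ⟨isHopfStarHom_classify σ hσ,
      (map_coaction_eq_iff e τ σ _).2 (classify_a σ hσ)⟩, ?_⟩
    rintro φ ⟨-, hφ⟩
    have h : (φ : UniversalAlgebra.{u, v} e τ →ₐ[ℂ] H) = classify e σ hσ :=
      algHom_ext fun i j => by
        change φ _ = classify e σ hσ _
        rw [(map_coaction_eq_iff e τ σ φ).1 hφ, classify_a]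
    exact BialgHom.ext fun x => AlgHom.congr_fun h x

end UniversalAlgebra

/-! ## Adapted bases -/

section Bases

variable {B : Type u} [Ring B] [Algebra ℂ B] [StarRing B] {τ : B →ₗ[ℂ] ℂ}

/-- Expand `(1 + x)* (1 + x) = 1 + 2x + x* x`; `τ` is real on every term except possibly `2x`, hence
also there. -/
theorem IsState.im_eq_zero (hτ : IsState τ) {x : B} (hx : star x = x) : (τ x).im = 0 := by
  have h1 := (hτ.nonneg x).2
  have h2 := (hτ.nonneg (1 + x)).2
  have h3 : star (1 + x) * (1 + x) = 1 + (2 : ℂ) • x + star x * x := by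
    rw [star_add, star_one, hx, two_smul]
    noncomm_ring
  rw [h3, map_add, map_add, map_smul, hτ.map_one, Complex.add_im, h1] at h2
  simpa using h2

variable [StarModule ℂ B]

theorem IsState.map_star (hτ : IsState τ) (x : B) : τ (star x) = star (τ x) := by
  have hsa : ∀ y : selfAdjoint B, star (τ y) = τ y := fun y =>
    Complex.conj_eq_iff_im.2 (hτ.im_eq_zero y.2)
  rw [← realPart_add_I_smul_imaginaryPart x]
  simp [(realPart x).2.star_eq, (imaginaryPart x).2.star_eq,
    -Complex.star_def, -RCLike.star_def, hsa]

/-- Self-adjoint elements span `B` over `ℂ`, so a basis can be extracted from them. -/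
theorem IsState.exists_isSelfAdjointBasis [FiniteDimensional ℂ B] (hτ : IsState τ) :
    ∃ (d : ℕ) (e : Module.Basis (Fin d) ℂ B), IsSelfAdjointBasis e τ := by
  obtain ⟨s, hs, hspan, hli⟩ := exists_linearIndependent ℂ (selfAdjoint B : Set B)
  rw [span_selfAdjoint] at hspan
  let e : Module.Basis s ℂ B := Module.Basis.mk hli (by rw [Subtype.range_coe, hspan])
  have : Finite s := Module.Finite.finite_basis e
  have h : ∀ i, star (e.reindex (Finite.equivFin s) i) = e.reindex (Finite.equivFin s) i := by
    intro i
    rw [Module.Basis.reindex_apply, Module.Basis.mk_apply]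
    exact hs ((Finite.equivFin s).symm i).2
  exact ⟨_, e.reindex (Finite.equivFin s), h, fun i => by rw [← hτ.map_star, h]⟩

/-- Faithfulness makes the GNS form `τ(x* y)` an inner product. -/
theorem IsState.exists_orthonormalBasis [FiniteDimensional ℂ B] (hτ : IsState τ)
    (hf : IsFaithful τ) : ∃ (d : ℕ) (g : Module.Basis (Fin d) ℂ B),
      ∀ i j, τ (star (g i) * g j) = if i = j then 1 else 0 := by
  let core : InnerProductSpace.Core ℂ B :=
    { inner := fun x y => τ (star x * y)
      conj_inner_symm := fun x y => by
        change star (τ (star y * x)) = _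
        rw [← hτ.map_star, star_mul, star_star]
      re_inner_nonneg := fun x => (hτ.nonneg x).1
      add_left := fun x y z => by rw [star_add, add_mul, map_add]
      smul_left := fun x y c => by
        rw [star_smul, smul_mul_assoc, map_smul]
        rfl
      definite := fun x hx => hf x hx }
  let : NormedAddCommGroup B := core.toNormedAddCommGroup
  let : InnerProductSpace ℂ B := InnerProductSpace.ofCore core.toCore
  let g := stdOrthonormalBasis ℂ B
  refine ⟨_, g.toBasis, fun i j => ?_⟩
  rw [g.coe_toBasis]
  exact orthonormal_iff_ite.1 g.orthonormal i j

end Bases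

/-! ## Unitary corepresentations -/

section UnitaryCorepresentation

variable {A : Type v} [Ring A] [HopfStarAlgebra A]

/-- A unitary corepresentation, given by a matrix. -/
structure IsUnitaryCorepresentation {ι : Type*} [Fintype ι] [DecidableEq ι] (w : Matrix ι ι A) :
    Prop where
  comul : ∀ i j, comul (R := ℂ) (w i j) = ∑ k, w i k ⊗ₜ[ℂ] w k j
  counit : ∀ i j, counit (R := ℂ) (w i j) = if i = j then 1 else 0
  star_mul_self : star w * w = 1
  mul_star_self : w * star w = 1

variable {ι κ : Type*} [Fintype ι] [DecidableEq ι] [Fintype κ] [DecidableEq κ]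

theorem IsUnitaryCorepresentation.submatrix {w : Matrix ι ι A} (hw : IsUnitaryCorepresentation w)
    (f : κ ≃ ι) : IsUnitaryCorepresentation (w.submatrix f f) where
  comul i j := by
    simp only [Matrix.submatrix_apply, hw.comul]
    exact (f.sum_comp fun k => w (f i) k ⊗ₜ[ℂ] w k (f j)).symm
  counit i j := by simp [hw.counit]
  star_mul_self := by
    rw [Matrix.star_eq_conjTranspose, Matrix.conjTranspose_submatrix, Matrix.submatrix_mul_equiv,
      ← Matrix.star_eq_conjTranspose, hw.star_mul_self, Matrix.submatrix_one_equiv]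
  mul_star_self := by
    rw [Matrix.star_eq_conjTranspose, Matrix.conjTranspose_submatrix, Matrix.submatrix_mul_equiv,
      ← Matrix.star_eq_conjTranspose, hw.mul_star_self, Matrix.submatrix_one_equiv]

/-- The tensor product of corepresentations. Entries need not commute, so in each unitarity relation
the inner pair is summed first, `w` in one and `w'` in the other. This makes the span of
coefficients closed under products. -/
theorem IsUnitaryCorepresentation.prod {w : Matrix ι ι A} {w' : Matrix κ κ A}
    (hw : IsUnitaryCorepresentation w) (hw' : IsUnitaryCorepresentation w') :
    IsUnitaryCorepresentation
      (.of fun p q => w p.1 q.1 * w' p.2 q.2 : Matrix (ι × κ) (ι × κ) A) where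
  comul p q := by
    simp only [Matrix.of_apply, Bialgebra.comul_mul, hw.comul, hw'.comul, Finset.sum_mul_sum,
      Algebra.TensorProduct.tmul_mul_tmul, Fintype.sum_prod_type]
  counit p q := by
    simp only [Matrix.of_apply, Bialgebra.counit_mul, hw.counit, hw'.counit, Prod.ext_iff,
      ite_and]
    split <;> simp
  star_mul_self := by
    refine Matrix.ext fun ⟨i, k⟩ ⟨j, l⟩ => ?_
    have h1 : ∑ p, star (w p i) * w p j = (1 : Matrix ι ι A) i j := by
      rw [← hw.star_mul_self]
      rfl
    have h2 : ∑ q, star (w' q k) * w' q l = (1 : Matrix κ κ A) k l := by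
      rw [← hw'.star_mul_self]
      rfl
    calc ∑ p : ι × κ, star (w p.1 i * w' p.2 k) * (w p.1 j * w' p.2 l)
        = ∑ q, star (w' q k) * (∑ p, star (w p i) * w p j) * w' q l := by
          rw [Fintype.sum_prod_type_right]
          simp only [star_mul, Finset.mul_sum, Finset.sum_mul, mul_assoc]
      _ = (1 : Matrix ι ι A) i j * (1 : Matrix κ κ A) k l := by
          rw [h1, ← h2, Matrix.one_apply]
          split <;> simp
      _ = _ := by
          simp only [Matrix.one_apply, Prod.mk.injEq, ite_and, mul_ite, mul_one, mul_zero]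
          split_ifs <;> rfl
  mul_star_self := by
    refine Matrix.ext fun ⟨i, k⟩ ⟨j, l⟩ => ?_
    have h1 : ∑ p, w i p * star (w j p) = (1 : Matrix ι ι A) i j := by
      rw [← hw.mul_star_self]
      rfl
    have h2 : ∑ q, w' k q * star (w' l q) = (1 : Matrix κ κ A) k l := by
      rw [← hw'.mul_star_self]
      rfl
    calc ∑ p : ι × κ, (w i p.1 * w' k p.2) * star (w j p.1 * w' l p.2)
        = ∑ p, w i p * (∑ q, w' k q * star (w' l q)) * star (w j p) := by
          rw [Fintype.sum_prod_type]
          simp only [star_mul, Finset.mul_sum, Finset.sum_mul, mul_assoc]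
      _ = (1 : Matrix ι ι A) i j * (1 : Matrix κ κ A) k l := by
          rw [h2, ← h1, Matrix.one_apply (i := k)]
          split <;> simp
      _ = _ := by
          simp only [Matrix.one_apply, Prod.mk.injEq, ite_and, mul_ite, mul_one, mul_zero]
          split_ifs <;> rfl

variable (A) in
/-- The set of matrix coefficients of unitary corepresentations. -/
def unitaryCoefficients : Set A := {x : A | ∃ (n : ℕ) (w : Matrix (Fin n) (Fin n) A),
    (∀ i j, Coalgebra.comul (R := ℂ) (w i j) = ∑ k, w i k ⊗ₜ[ℂ] w k j) ∧
    (∀ i j, Coalgebra.counit (R := ℂ) (w i j) = if i = j then 1 else 0) ∧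
    star w * w = 1 ∧ w * star w = 1 ∧ ∃ i j, x = w i j}

theorem IsUnitaryCorepresentation.mem_unitaryCoefficients {w : Matrix ι ι A}
    (hw : IsUnitaryCorepresentation w) (i j : ι) : w i j ∈ unitaryCoefficients A := by
  let f := Fintype.equivFin ι
  have h := hw.submatrix f.symm
  exact ⟨_, _, h.comul, h.counit, h.star_mul_self, h.mul_star_self, f i, f j, by simp⟩

theorem mul_mem_unitaryCoefficients {x y : A} (hx : x ∈ unitaryCoefficients A)
    (hy : y ∈ unitaryCoefficients A) : x * y ∈ unitaryCoefficients A := by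
  obtain ⟨n, w, h1, h2, h3, h4, i, j, rfl⟩ := hx
  obtain ⟨m, w', h1', h2', h3', h4', i', j', rfl⟩ := hy
  exact (IsUnitaryCorepresentation.prod ⟨h1, h2, h3, h4⟩
    ⟨h1', h2', h3', h4'⟩).mem_unitaryCoefficients (i, i') (j, j')

theorem one_mem_unitaryCoefficients : (1 : A) ∈ unitaryCoefficients A :=
  IsUnitaryCorepresentation.mem_unitaryCoefficients (w := (1 : Matrix (Fin 1) (Fin 1) A))
    ⟨fun i j => by
        rw [Subsingleton.elim i 0, Subsingleton.elim j 0]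
        simp [Algebra.TensorProduct.one_def],
      fun i j => by
        rw [Subsingleton.elim i 0, Subsingleton.elim j 0]
        simp, by simp, by simp⟩ 0 0

variable (A) in
/-- The subalgebra spanned by the matrix coefficients of unitary corepresentations. -/
def unitaryCoefficientAlgebra : Subalgebra ℂ A :=
  (Submodule.span ℂ (unitaryCoefficients A)).toSubalgebra
    (Submodule.subset_span one_mem_unitaryCoefficients)
    fun x y hx hy => by
      have h := Submodule.mul_mem_mul hx hy
      rw [Submodule.span_mul_span] at h
      refine Submodule.span_mono ?_ h
      rintro _ ⟨x, hx, y, hy, rfl⟩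
      exact mul_mem_unitaryCoefficients hx hy

end UnitaryCorepresentation

/-! ### Unitarity of coactions in an orthonormal basis. -/

section UnitaryCoaction

variable {B : Type u} [Ring B] [Algebra ℂ B] [StarRing B] [StarModule ℂ B] {d n : ℕ}
  {τ : B →ₗ[ℂ] ℂ} {H : Type v} [Ring H] [HopfStarAlgebra H]

/-- Invariance of `τ` at `(g i)* (g j)` says `w* w = 1`. Since `S(w)` is a two-sided inverse of `w`,
it equals `w*`, and `w w* = 1` follows. -/
theorem StarCoaction.isUnitaryCorepresentation (σ : StarCoaction B H) (hσ : σ.Preserves τ)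
    (g : Module.Basis (Fin d) ℂ B) (hg : ∀ i j, τ (star (g i) * g j) = if i = j then 1 else 0) :
    IsUnitaryCorepresentation (σ.matrix g) := by
  have h : star (σ.matrix g) * σ.matrix g = 1 := by
    refine Matrix.ext fun i j => ?_
    have h1 := hσ (star (g i) * g j)
    rw [map_mul, σ.coact_star, σ.coact_basis, σ.coact_basis, star_sum, Finset.sum_mul_sum] at h1
    simp only [map_sum, TensorProduct.star_tmul, Algebra.TensorProduct.tmul_mul_tmul,
      LinearMap.rTensor_tmul, TensorProduct.lid_tmul, hg, ite_smul, one_smul, zero_smul,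
      Finset.sum_ite_eq, Finset.mem_univ, if_true] at h1
    rw [Matrix.one_apply, ← h1]
    rfl
  refine ⟨σ.comul_matrix g, σ.counit_matrix g, h, ?_⟩
  rw [left_inv_eq_right_inv h (σ.matrix_mul_antipode g)]
  exact σ.matrix_mul_antipode g

theorem StarCoaction.matrix_mem_span (σ : StarCoaction B H) (e : Module.Basis (Fin d) ℂ B)
    (g : Module.Basis (Fin n) ℂ B) (i j : Fin d) :
    σ.matrix e i j ∈ Submodule.span ℂ (Set.range fun p : Fin n × Fin n => σ.matrix g p.1 p.2) := by
  have h : σ.coact (e j) = ∑ k, g.repr (e j) k • σ.coact (g k) := by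
    conv_lhs => rw [← g.sum_repr (e j)]
    simp only [map_sum, map_smul]
  change tensorCoeff e i (σ.coact (e j)) ∈ _
  rw [h, map_sum]
  refine Submodule.sum_mem _ fun k _ => ?_
  rw [map_smul, σ.coact_basis, map_sum]
  refine Submodule.smul_mem _ _ (Submodule.sum_mem _ fun l _ => ?_)
  rw [tensorCoeff_tmul]
  exact Submodule.smul_mem _ _ (Submodule.subset_span ⟨(l, k), rfl⟩)

end UnitaryCoaction

/-! ### The universal algebra of a faithful state is a CQG algebra. -/

namespace UniversalAlgebra

variable {B : Type u} [Ring B] [Algebra ℂ B] [StarRing B] [StarModule ℂ B]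
  {d : ℕ} (e : Module.Basis (Fin d) ℂ B) {τ : B →ₗ[ℂ] ℂ} [IsSelfAdjointBasis e τ]

theorem matrix_coaction (i j : Fin d) :
    (coaction.{u, v} e τ).matrix e i j = a e τ 0 i j := by
  change tensorCoeff e i ((coaction.{u, v} e τ).coact (e j)) = _
  rw [coaction_basis, tensorCoeff_sum]

/-- The coefficient space `W` of the coaction does not depend on the basis. The self-adjoint basis
shows it is stable under `*`, the orthonormal one, where `S(w) = w*`, that it is stable under `S`.
All generators arise from `a 0` by `S` and `*`, so they lie in `W`, hence in the algebra of unitary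
coefficients. -/
theorem isCQGAlgebra [FiniteDimensional ℂ B] (hτ : IsState τ) (hf : IsFaithful τ) :
    IsCQGAlgebra (UniversalAlgebra.{u, v} e τ) := by
  obtain ⟨n, g, hg⟩ := hτ.exists_orthonormalBasis hf
  set ρ := coaction.{u, v} e τ
  have hw := ρ.isUnitaryCorepresentation (coaction_preserves e τ) g hg
  have hS' : star (ρ.matrix g) = (ρ.matrix g).map (antipode ℂ) :=
    left_inv_eq_right_inv hw.star_mul_self (ρ.matrix_mul_antipode g)
  have hS : ∀ i j, antipode ℂ (ρ.matrix g i j) = star (ρ.matrix g j i) := fun i j =>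
    (congrFun (congrFun hS' i) j).symm
  let W := Submodule.span ℂ (Set.range fun p : Fin n × Fin n => ρ.matrix g p.1 p.2)
  have hWe : W = Submodule.span ℂ (Set.range fun p : Fin d × Fin d => ρ.matrix e p.1 p.2) := by
    apply le_antisymm <;> rw [Submodule.span_le]
    · rintro _ ⟨p, rfl⟩
      exact ρ.matrix_mem_span g e p.1 p.2
    · rintro _ ⟨p, rfl⟩
      exact ρ.matrix_mem_span e g p.1 p.2
  have hstar : ∀ x ∈ W, star x ∈ W := by
    intro x hx
    rw [hWe] at hx ⊢
    induction hx using Submodule.span_induction with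
    | mem x hx =>
      obtain ⟨p, rfl⟩ := hx
      dsimp only
      rw [ρ.star_matrix (τ := τ) e]
      exact Submodule.subset_span ⟨p, rfl⟩
    | zero => simp
    | add x y _ _ hx hy => rw [star_add]; exact add_mem hx hy
    | smul c x _ hx => rw [star_smul]; exact Submodule.smul_mem _ _ hx
  have hanti : ∀ x ∈ W, antipode ℂ x ∈ W := by
    intro x hx
    induction hx using Submodule.span_induction with
    | mem x hx =>
      obtain ⟨p, rfl⟩ := hx
      dsimp only
      rw [hS]
      exact hstar _ (Submodule.subset_span ⟨(p.2, p.1), rfl⟩)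
    | zero => simp
    | add x y _ _ hx hy => rw [map_add]; exact add_mem hx hy
    | smul c x _ hx => rw [map_smul]; exact Submodule.smul_mem _ _ hx
  have hnat : ∀ (k : ℕ) i j, a e τ (k : ℤ) i j ∈ W := by
    intro k
    induction k with
    | zero =>
      intro i j
      rw [Nat.cast_zero, ← matrix_coaction e, hWe]
      exact Submodule.subset_span ⟨(i, j), rfl⟩
    | succ k ih =>
      intro i j
      rw [Nat.cast_succ, ← antipode_b, ← antipode_a]
      exact hanti _ (hanti _ (ih i j))
  -- Negative indices are reached by the involution, which sends `a k` to `a (-k)`.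
  have ha : ∀ k i j, a e τ k i j ∈ W := by
    intro k i j
    obtain ⟨k, rfl | rfl⟩ := k.eq_nat_or_neg
    · exact hnat k i j
    · rw [← star_a]
      exact hstar _ (hnat k i j)
  have hW : W ≤ Subalgebra.toSubmodule (unitaryCoefficientAlgebra (UniversalAlgebra e τ)) := by
    refine Submodule.span_mono ?_
    rintro _ ⟨p, rfl⟩
    exact hw.mem_unitaryCoefficients p.1 p.2
  refine eq_top_iff.2 fun x _ => ?_
  change x ∈ unitaryCoefficientAlgebra (UniversalAlgebra e τ)
  induction x using induction with
  | algebraMap c => exact Subalgebra.algebraMap_mem _ c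
  | a k i j => exact hW (ha k i j)
  | b k i j =>
    rw [← antipode_a]
    exact hW (hanti _ (ha k i j))
  | add x y hx hy => exact add_mem (hx trivial) (hy trivial)
  | mul x y hx hy => exact mul_mem (hx trivial) (hy trivial)

end UniversalAlgebra

/-! ## Comparison of the two universal properties -/

section MapId

variable {B : Type u} [Ring B] [Algebra ℂ B] {A : Type v} [Ring A] [HopfStarAlgebra A]

theorem map_id_comp_apply {K L : Type*} [Ring K] [HopfStarAlgebra K] [Ring L] [HopfStarAlgebra L]
    (ψ : K →ₐc[ℂ] L) (φ : A →ₐc[ℂ] K) (t : B ⊗[ℂ] A) :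
    TensorProduct.map LinearMap.id (ψ.comp φ : A →ₗ[ℂ] L) t =
      TensorProduct.map LinearMap.id (ψ : K →ₗ[ℂ] L)
        (TensorProduct.map LinearMap.id (φ : A →ₗ[ℂ] K) t) := by
  induction t with
  | zero => simp
  | add x y hx hy => simp only [map_add, hx, hy]
  | tmul m x => rfl

theorem map_id_id_apply (t : B ⊗[ℂ] A) :
    TensorProduct.map LinearMap.id (BialgHom.id ℂ A : A →ₗ[ℂ] A) t = t := by
  induction t with
  | zero => simp
  | add x y hx hy => simp only [map_add, hx, hy]
  | tmul m x => rfl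

end MapId

section Comparison

variable {B : Type u} [Ring B] [Algebra ℂ B] [StarRing B] [StarModule ℂ B] {τ : B →ₗ[ℂ] ℂ}
  {A : Type v} [Ring A] [HopfStarAlgebra A] {U : Type v} [Ring U] [HopfStarAlgebra U]

theorem IsQuantumAutGroup.isCompactQuantumAutGroup {ρ : StarCoaction B A}
    (h : IsQuantumAutGroup.{u, v} τ ρ) (hA : IsCQGAlgebra A) :
    IsCompactQuantumAutGroup.{u, v} τ ρ :=
  ⟨hA, h.preserves, fun H _ _ σ _ hσ => h.initial H σ hσ⟩

/-- Since `U` is itself a CQG algebra, there are morphisms `ψ : A → U` and `φ : U → A` with `φ ∘ ψ =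
id`. Existence for `A` is composition with `ψ`; for uniqueness, `θ ∘ φ` is determined on `U`, and `θ
= θ ∘ φ ∘ ψ`. -/
theorem IsCompactQuantumAutGroup.isQuantumAutGroup {ρ : StarCoaction B A}
    (h : IsCompactQuantumAutGroup.{u, v} τ ρ) {υ : StarCoaction B U}
    (hU : IsQuantumAutGroup.{u, v} τ υ) (hUc : IsCQGAlgebra U) :
    IsQuantumAutGroup.{u, v} τ ρ where
  preserves := h.preserves
  initial H _ _ σ hσ := by
    obtain ⟨ψ, ⟨hψ, hψ'⟩, -⟩ := h.initial U υ hUc hU.preserves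
    obtain ⟨φ, ⟨hφ, hφ'⟩, -⟩ := hU.initial A ρ h.preserves
    obtain ⟨χ, ⟨hχ, hχ'⟩, huniq⟩ := hU.initial H σ hσ
    have hid : φ.comp ψ = BialgHom.id ℂ A :=
      (h.initial A ρ h.isCQG h.preserves).unique
        ⟨hφ.comp hψ, fun m => by rw [map_id_comp_apply, hψ', hφ']⟩
        ⟨.id, fun m => map_id_id_apply _⟩
    refine ⟨χ.comp ψ, ⟨hχ.comp hψ, fun m => by rw [map_id_comp_apply, hψ', hχ']⟩, ?_⟩
    rintro θ ⟨hθ, hθ'⟩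
    rw [← huniq (θ.comp φ) ⟨hθ.comp hφ, fun m => by rw [map_id_comp_apply, hφ', hθ']⟩]
    exact BialgHom.ext fun x => congrArg θ (BialgHom.congr_fun hid x).symm

end Comparison

end QuantumSymmetry

end

open QuantumSymmetry
theorem mainTheorem9 {B : Type u} [Ring B] [Algebra ℂ B] [StarRing B] [StarModule ℂ B]
    [FiniteDimensional ℂ B] (τ : B →ₗ[ℂ] ℂ) (hτ : IsState τ) :
    -- the quantum automorphism group exists among all Hopf `*`-algebras coacting on `(B, τ)`
    (∃ (A : Type v) (_ : Ring A) (_ : HopfStarAlgebra A) (ρ : StarCoaction B A),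
      IsQuantumAutGroup.{u, v} τ ρ) ∧
    -- and, for a faithful state, among compact quantum groups
    (IsFaithful τ →
      ∃ (A : Type v) (_ : Ring A) (_ : HopfStarAlgebra A) (ρ : StarCoaction B A),
        IsCompactQuantumAutGroup.{u, v} τ ρ) ∧
    -- in both cases its finite dual, with the dual action, is the quantum Galois group
    (∀ (A : Type v) [Ring A] [HopfStarAlgebra A] (ρ : StarCoaction B A),
      (IsQuantumAutGroup.{u, v} τ ρ ∨ (IsFaithful τ ∧ IsCompactQuantumAutGroup.{u, v} τ ρ)) →
        IsQGal.{u, v} (⊥ : StarSubalgebra ℂ B) τ ρ.dualAction ∧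
        ∀ (G : Type v) [Ring G] [HopfStarAlgebra G] (β : StarAction G B),
          IsQGal.{u, v} (⊥ : StarSubalgebra ℂ B) τ β →
            ∃ e : G ≃ₐc[ℂ] FiniteDual A,
              IsHopfStarHom (e : G →ₐc[ℂ] FiniteDual A) ∧
              ∀ g b, ρ.dualAction.act (e g) b = β.act g b) := by
  obtain ⟨d, e, he⟩ := hτ.exists_isSelfAdjointBasis
  have hU := UniversalAlgebra.isQuantumAutGroup.{u, v} e τ
  refine ⟨⟨_, _, _, _, hU⟩, fun hf => ⟨_, _, _, _, hU.isCompactQuantumAutGroup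
    (UniversalAlgebra.isCQGAlgebra e hτ hf)⟩, fun A _ _ ρ hρ => ?_⟩
  -- The target `H°` need not be a CQG algebra, so the compact universal property is first upgraded
  -- to the one among all Hopf `*`-algebras.
  have hρ' : IsQuantumAutGroup.{u, v} τ ρ := by
    obtain hρ | ⟨hf, hρ⟩ := hρ
    · exact hρ
    · exact hρ.isQuantumAutGroup hU (UniversalAlgebra.isCQGAlgebra e hτ hf)
  exact ⟨hρ'.isQGal, fun G _ _ β hβ => hβ.exists_equiv hρ'.isQGal⟩
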